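/- Conventions. All subcategories of an additive category $\mathcal A$ are full and closed under isomorphisms; an additive subcategory contains $0$ and is closed under finite direct sums. Let $\mathcal X$ be an additive subcategory. A morphism $f\colon A\to B$ is $\mathcal X$-monic if every morphism from $A$ to an object of $\mathcal X$ factors through $f$; it is an $\mathcal X$-preenvelope if moreover $B\in\mathcal X$. $\mathcal X$-epic morphisms and $\mathcal X$-precovers are defined dually. A weak cokernel of $f\colon A\to B$ is a $g\colon B\to C$ with $gf=0$ through which every morphism $k$ from $B$ with $kf=0$ factors; weak kernels are dual. For an additive subcategory $\mathcal C\supseteq\mathcal X$, the stable category $\mathcal C/\mathcal X$ has the objects of $\mathcal C$ and as morphisms those of $\mathcal C$ modulo the ones that factor through an object of $\mathcal X$; $\underline f$ is the class of $f$. Exact categories. An exact structure $\mathcal E$ on $\mathcal A$ is meant in the sense of Quillen and Keller; its members are called conflations, and $\mathrm{Ext}^1(C,A)$ is the group of equivalence classes of conflations $A\to B\to C$. A pair $(\mathcal C,\mathcal F)$ of classes of objects is a cotorsion pair if $\mathcal C=\{C:\mathrm{Ext}^1(C,\mathcal F)=0\}$ and $\mathcal F=\{F:\mathrm{Ext}^1(\mathcal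 C,F)=0\}$; it is complete if for each $A\in\mathcal A$ there are conflations $F\to C\to A$ and $A\to F'\to C'$ with $C,C'\in\mathcal C$ and $F,F'\in\mathcal F$. A Hovey triple is a triple $(\mathcal C,\mathcal W,\mathcal F)$ of classes of objects such that $\mathcal W$ is thick (closed under direct summands, and if two of the three terms of a conflation lie in $\mathcal W$, so does the third) and $(\mathcal C,\mathcal W\cap\mathcal F)$ and $(\mathcal C\cap\mathcal W,\mathcal F)$ are complete cotorsion pairs. Localization triples. Let $\mathcal X,\mathcal C,\mathcal D$ be additive subcategories of $\mathcal A$ with $\mathcal X\subseteq\mathcal C\cap\mathcal D$. Then $(\mathcal C,\mathcal X,\mathcal D)$ is a localization triple if for each $A\in\mathcal A$ one can choose (a) a sequence $W_A\xrightarrow{\omega_A}Q(A)\xrightarrow{r_A}A$ with $r_A$ a $\mathcal C$-precover, $\omega_A$ a weak kernel of $r_A$, and $\mathrm{Hom}_{\mathcal A/\mathcal X}(\mathcal C,W_A)=0$; (b) a sequence $A\xrightarrow{j^A}R(A)\xrightarrow{\tau^A}W^A$ with $j^A$ a $\mathcal D$-preenvelope, $\tau^A$ a weak cokernel of $j^A$,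 and $\mathrm{Hom}_{\mathcal A/\mathcal X}(W^A,\mathcal D)=0$; (c) such that $Q(A)\in\mathcal C\cap\mathcal D$ if $A\in\mathcal D$, and $R(A)\in\mathcal C\cap\mathcal D$ if $A\in\mathcal C$. Partial right triangulated categories. Let $\Sigma$ be an additive endofunctor of $\mathcal A$, let $\mathcal X\subseteq\mathcal C$ be additive subcategories, and let $\mathcal R$ be a class of sequences $A\xrightarrow{f}B\xrightarrow{g}C\xrightarrow{h}\Sigma A$ with $C\in\mathcal C$, $g$ a weak cokernel of $f$ and $h$ a weak cokernel of $g$, closed under isomorphisms and finite direct sums. The members of $\mathcal R$ are called right $\mathcal C$-triangles. $(\mathcal A,\Sigma,\mathcal R,\mathcal X)$ is partial right triangulated if: (1) (i) each $A\in\mathcal C$ has a right $\mathcal C$-triangle $A\xrightarrow{i}X\to U\to\Sigma A$ with $i$ an $\mathcal X$-preenvelope; (ii) $A\xrightarrow{(1,f)^t}A\oplus B\xrightarrow{(f,-1)}B\xrightarrow{0}\Sigma A$ is in $\mathcal R$ for each $f\colon A\to B$ in $\mathcal C$; (iii) if $A\xrightarrow{i}X\to U\to\Sigma A$ is in $\mathcal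 R$ with $A\in\mathcal C$ and $i$ an $\mathcal X$-preenvelope, then for each $f\colon A\to B$ in $\mathcal C$ there is a right $\mathcal C$-triangle $A\xrightarrow{(i,f)^t}X\oplus B\to N\to\Sigma A$. (2) For every morphism $(\alpha,\beta,\gamma)$ (with fourth component $\Sigma\alpha$) from a right $\mathcal C$-triangle with first morphism $f$ to a right $\mathcal C$-triangle $A'\to X\xrightarrow{s}U\to\Sigma A'$ with $X\in\mathcal X$, if $\alpha$ factors through $f$, then $\gamma$ factors through $s$. (3) Given two right $\mathcal C$-triangles with first morphisms $f\colon A\to B$ and $f'\colon A'\to B'$, and $\alpha\colon A\to A'$, $\beta\colon B\to B'$ with $\beta f=f'\alpha$, there is $\gamma$ making $(\alpha,\beta,\gamma)$ a morphism of triangles. (4) If $A\xrightarrow{f}B\xrightarrow{l}C'\xrightarrow{m}\Sigma A$, $B\xrightarrow{g}C\xrightarrow{h}A'\xrightarrow{j}\Sigma B$ and $A\xrightarrow{gf}C\xrightarrow{a}B'\xrightarrow{b}\Sigma A$ are in $\mathcal R$, where $A,B,C\in\mathcal C$ and $f,g$ are $\mathcal X$-monic, then there are $r\colon C'\to B'$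 and $s\colon B'\to A'$ with $rl=ag$, $br=m$, $sa=h$, $js=\Sigma(f)b$, with $r$ $\mathcal X$-monic and $C'\xrightarrow{r}B'\xrightarrow{s}A'\xrightarrow{\Sigma(l)j}\Sigma C'$ in $\mathcal R$. Partial left triangulated categories $(\mathcal A,\Omega,\mathcal L,\mathcal X)$, where $\mathcal L$ is a class of sequences $\Omega N\to L\to M\to N$ with $L\in\mathcal F$ (left $\mathcal F$-triangles), are defined dually. Stabilizing subcategories. Let $(\mathcal A,\Sigma,\mathcal R,\mathcal X)$ be partial right triangulated. Choose for each $A\in\mathcal C$ a right $\mathcal C$-triangle $A\xrightarrow{i^A}X^A\xrightarrow{p^A}U^A\xrightarrow{q^A}\Sigma A$ with $i^A$ an $\mathcal X$-preenvelope. This defines a functor $\Sigma^{\mathcal X}\colon\mathcal C/\mathcal X\to\mathcal C/\mathcal X$ with $\Sigma^{\mathcal X}(A)=U^A$, which sends $\underline f$ to $\underline\kappa$ for any morphism of triangles $(f,\sigma,\kappa)$ between the chosen triangles. Each right $\mathcal C$-triangle $A\xrightarrow{f}B\xrightarrow{g}C\to\Sigma A$ with $A,B\in\mathcal C$ and $f$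 $\mathcal X$-monic, together with a morphism of triangles $(1_A,\delta,\xi)$ from it to the chosen triangle of $A$, gives a standard sequence $A\xrightarrow{\underline f}B\xrightarrow{\underline g}C\xrightarrow{\underline\xi}\Sigma^{\mathcal X}(A)$; let $\Delta^{\mathcal X}$ be the class of sequences in $\mathcal C/\mathcal X$ isomorphic to standard ones. An additive subcategory $\mathcal G$ with $\mathcal X\subseteq\mathcal G\subseteq\mathcal C$ is special preenveloping if each $A\in\mathcal C$ has a right $\mathcal C$-triangle $A\xrightarrow{j^A}R(A)\to W^A\to\Sigma A$ with $j^A$ a $\mathcal G$-preenvelope and $\mathrm{Hom}_{\mathcal C/\mathcal X}(W^A,\mathcal G)=0$. A choice of these defines a functor $R\colon\mathcal C/\mathcal X\to\mathcal G/\mathcal X$, $\underline f\mapsto\underline{\hat f}$ with $\hat fj^A=j^Bf$. A special preenveloping $\mathcal G$ is stabilizing if (for all choices above) for each $f\colon A\to B$ in $\mathcal C$ and all sequences $A\xrightarrow{\underline f}B\to C\to\Sigma^{\mathcal X}(A)$ and $R(A)\xrightarrow{\underline{\hat f}}R(B)\to D\to\Sigma^{\mathcal X}(R(A))$ in $\Delta^{\mathcal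 X}$ there is $\underline t\colon C\to D$ in $\mathcal C/\mathcal X$ such that $(\underline j^A,\underline j^B,\underline t,\Sigma^{\mathcal X}(\underline j^A))$ is a morphism between them and $R(\underline t)$ is an isomorphism. Stabilizing subcategories of a partial left triangulated category are defined dually. Pre-partial triangulated categories. $(\mathcal A,\Omega,\Sigma,\mathcal L,\mathcal R,\mathcal X)$ is pre-partial triangulated if $(\mathcal A,\Sigma,\mathcal R,\mathcal X)$ is partial right triangulated, with $\mathcal R$ consisting of right $\mathcal C$-triangles, $(\mathcal A,\Omega,\mathcal L,\mathcal X)$ is partial left triangulated, with $\mathcal L$ consisting of left $\mathcal F$-triangles, and: (a) $(\Omega,\Sigma)$ is an adjoint pair, with adjunction isomorphism $\psi_{A,B}\colon\mathrm{Hom}(\Omega A,B)\to\mathrm{Hom}(A,\Sigma B)$; (b) $\mathcal C\cap\mathcal F$ is stabilizing in both $(\mathcal A,\Sigma,\mathcal R,\mathcal X)$ and $(\mathcal A,\Omega,\mathcal L,\mathcal X)$; and for all $A\xrightarrow{f}B\xrightarrow{g}C\xrightarrow{h}\Sigma A$ in $\mathcal R$ with $f$ $\mathcal X$-monic and $\Omega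 N\xrightarrow{u}L\xrightarrow{v}M\xrightarrow{w}N$ in $\mathcal L$ with $w$ $\mathcal X$-epic, and $\beta\colon B\to M$: (c) (i) if $\gamma\colon C\to N$ satisfies $\gamma g=w\beta$, there is $\alpha\colon A\to L$ with $v\alpha=\beta f$ and $u\,\Omega(\gamma)=-\alpha\,\psi^{-1}_{C,A}(h)$; (ii) if $\alpha\colon A\to L$ satisfies $v\alpha=\beta f$, there is $\gamma\colon C\to N$ with $\gamma g=w\beta$ and $\Sigma(\alpha)h=-\psi_{N,L}(u)\gamma$; (d) if $A\in\mathcal C\cap\mathcal F$, $B\in\mathcal X$, $v\alpha=\beta f$, $\gamma g=w\beta$, $u\,\Omega(\gamma)=-\alpha\,\psi^{-1}_{C,A}(h)$ and $\gamma$ factors through $w$, then $\alpha$ factors through $f$; (e) if $N\in\mathcal C\cap\mathcal F$, $M\in\mathcal X$, $v\alpha=\beta f$, $\gamma g=w\beta$, $\Sigma(\alpha)h=-\psi_{N,L}(u)\gamma$ and $\alpha$ factors through $f$, then $\gamma$ factors through $w$. Theorem. Let $(\mathcal A,\mathcal E)$ be an arbitrary exact category, $(\mathcal C,\mathcal W,\mathcal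 F)$ a Hovey triple in it and $\mathcal X=\mathcal C\cap\mathcal W\cap\mathcal F$. Let $\mathrm R(\mathcal C)$ be the class of sequences $A\to B\to C\to0$ with $A\to B\to C$ a conflation and $C\in\mathcal C$, and $\mathrm L(\mathcal F)$ the class of sequences $0\to K\to A\to B$ with $K\to A\to B$ a conflation and $K\in\mathcal F$. Then (i) $(\mathcal C,\mathcal X,\mathcal F)$ is a localization triple; (ii) $(\mathcal A,0,0,\mathrm L(\mathcal F),\mathrm R(\mathcal C),\mathcal X)$ is a pre-partial triangulated category. -/

import Mathlib

open CategoryTheory CategoryTheory.Limits Opposite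
open scoped ZeroObject

universe v u

namespace ExactHomotopy

/-! ### Approximations, weak (co)kernels and stable categories -/

section Basic

variable {𝓐 : Type u} [Category.{v} 𝓐]

/-- `f` factors through an object of `X`. -/
def FactorsThrough (X : ObjectProperty 𝓐) {A B : 𝓐} (f : A ⟶ B) : Prop :=
  ∃ Z : 𝓐, X Z ∧ ∃ (a : A ⟶ Z) (b : Z ⟶ B), a ≫ b = f

/-- `f : A ⟶ B` is `X`-monic: `Hom(B, Z) → Hom(A, Z)` is surjective for all `Z` in `X`. -/
def IsMonic (X : ObjectProperty 𝓐) {A B : 𝓐} (f : A ⟶ B) : Prop :=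
  ∀ Z : 𝓐, X Z → ∀ k : A ⟶ Z, ∃ l : B ⟶ Z, f ≫ l = k

/-- `f : A ⟶ B` is `X`-epic: `Hom(Z, A) → Hom(Z, B)` is surjective for all `Z` in `X`. -/
def IsEpic (X : ObjectProperty 𝓐) {A B : 𝓐} (f : A ⟶ B) : Prop :=
  ∀ Z : 𝓐, X Z → ∀ k : Z ⟶ B, ∃ l : Z ⟶ A, l ≫ f = k

/-- An `X`-preenvelope of `A`. -/
def IsPreenvelope (X : ObjectProperty 𝓐) {A B : 𝓐} (f : A ⟶ B) : Prop :=
  X B ∧ IsMonic X f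

/-- An `X`-precover of `B`. -/
def IsPrecover (X : ObjectProperty 𝓐) {A B : 𝓐} (f : A ⟶ B) : Prop :=
  X A ∧ IsEpic X f

variable [Preadditive 𝓐]

/-- `g` is a weak cokernel of `f`. -/
def IsWeakCokernel {A B C : 𝓐} (f : A ⟶ B) (g : B ⟶ C) : Prop :=
  f ≫ g = 0 ∧ ∀ (T : 𝓐) (k : B ⟶ T), f ≫ k = 0 → ∃ l : C ⟶ T, g ≫ l = k

/-- `f` is a weak kernel of `g`. -/
def IsWeakKernel {A B C : 𝓐} (f : A ⟶ B) (g : B ⟶ C) : Prop :=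
  f ≫ g = 0 ∧ ∀ (T : 𝓐) (k : T ⟶ B), k ≫ g = 0 → ∃ l : T ⟶ A, l ≫ f = k

/-- `W` lies in the right perpendicular class of `C` in the stable category modulo `X`: every
morphism from an object of `C` to `W` becomes zero modulo `X`. -/
def RightPerp (C X : ObjectProperty 𝓐) : ObjectProperty 𝓐 := fun W =>
  ∀ A : 𝓐, C A → ∀ f : A ⟶ W, FactorsThrough X f

/-- `W` lies in the left perpendicular class of `D` in the stable category modulo `X`: every
morphism from `W` to an object of `D` becomes zero modulo `X`. -/
def LeftPerp (X D : ObjectProperty 𝓐) : ObjectProperty 𝓐 := fun W =>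
  ∀ B : 𝓐, D B → ∀ f : W ⟶ B, FactorsThrough X f

/-- Two morphisms of the full subcategory `C` are identified modulo `X` if their difference
factors through an object of `X`. -/
def StableRel (C X : ObjectProperty 𝓐) : HomRel C.FullSubcategory := fun _ _ f g =>
  FactorsThrough X (f.hom - g.hom)

/-- The stable category `C/X` of the full subcategory `C` modulo `X`. -/
abbrev StableCat (C X : ObjectProperty 𝓐) := CategoryTheory.Quotient (StableRel C X)

/-- The canonical functor `C ⥤ C/X`. -/
abbrev toStable (C X : ObjectProperty 𝓐) : C.FullSubcategory ⥤ StableCat C X :=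
  CategoryTheory.Quotient.functor (StableRel C X)

variable [HasBinaryBiproducts 𝓐]

/-- `P` is (the class of objects of) an additive subcategory, full and closed under
isomorphisms. -/
structure IsAdditiveSubcategory (P : ObjectProperty 𝓐) : Prop where
  of_iso : ∀ A B : 𝓐, (A ≅ B) → P A → P B
  exists_zero : ∃ A : 𝓐, IsZero A ∧ P A
  biprod : ∀ A B : 𝓐, P A → P B → P (A ⊞ B)


end Basic

/-! ### Right sequences -/

/-- A right `S`-sequence `X ⟶ Y ⟶ Z ⟶ S X`, for an endofunctor `S`. -/
structure RightSeq {𝓑 : Type u} [Category.{v} 𝓑] (S : 𝓑 ⥤ 𝓑) where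
  X : 𝓑
  Y : 𝓑
  Z : 𝓑
  f : X ⟶ Y
  g : Y ⟶ Z
  h : Z ⟶ S.obj X

/-- The right `S`-sequences `s` and `t` are isomorphic. -/
def RightSeq.Isomorphic {𝓑 : Type u} [Category.{v} 𝓑] {S : 𝓑 ⥤ 𝓑} (s t : RightSeq S) : Prop :=
  ∃ (a : s.X ≅ t.X) (b : s.Y ≅ t.Y) (c : s.Z ≅ t.Z),
    s.f ≫ b.hom = a.hom ≫ t.f ∧ s.g ≫ c.hom = b.hom ≫ t.g ∧ s.h ≫ S.map a.hom = c.hom ≫ t.h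

/-- A left `O`-sequence `O N ⟶ L ⟶ M ⟶ N`, for an endofunctor `O`. -/
structure LeftSeq {𝓑 : Type u} [Category.{v} 𝓑] (O : 𝓑 ⥤ 𝓑) where
  L : 𝓑
  M : 𝓑
  N : 𝓑
  u : O.obj N ⟶ L
  v : L ⟶ M
  w : M ⟶ N

/-- A right sequence `N ⟶ M ⟶ L ⟶ O N` of the opposite category, read as a left sequence. -/
def LeftSeq.ofOp {𝓑 : Type u} [Category.{v} 𝓑] {O : 𝓑 ⥤ 𝓑} (s : RightSeq O.op) : LeftSeq O where
  L := s.Z.unop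
  M := s.Y.unop
  N := s.X.unop
  u := s.h.unop
  v := s.g.unop
  w := s.f.unop

section Partial

variable {𝓐 : Type u} [Category.{v} 𝓐] [Preadditive 𝓐] [HasBinaryBiproducts 𝓐]

/-- The direct sum of two right `S`-sequences. -/
noncomputable def RightSeq.sum {S : 𝓐 ⥤ 𝓐} (s t : RightSeq S) : RightSeq S where
  X := s.X ⊞ t.X
  Y := s.Y ⊞ t.Y
  Z := s.Z ⊞ t.Z
  f := biprod.map s.f t.f
  g := biprod.map s.g t.g
  h := biprod.desc (s.h ≫ S.map biprod.inl) (t.h ≫ S.map biprod.inr)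

/-- `s` is a right `C`-sequence. -/
def RightSeq.IsRightCSeq {S : 𝓐 ⥤ 𝓐} (s : RightSeq S) (C : ObjectProperty 𝓐) : Prop :=
  C s.Z ∧ IsWeakCokernel s.f s.g ∧ IsWeakCokernel s.g s.h

/-! ### Partial right and left triangulated categories -/

/-- The quadruple `(𝓐, S, R, X)`, with `R` a class of right `C`-sequences (the right
`C`-triangles), is a partial right triangulated category. -/
structure IsPartialRight (S : 𝓐 ⥤ 𝓐) (R : Set (RightSeq S)) (C X : ObjectProperty 𝓐) : Prop where
  functor_additive : S.Additive
  additive_C : IsAdditiveSubcategory C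
  additive_X : IsAdditiveSubcategory X
  X_le : X ≤ C
  isRightCSeq : ∀ s ∈ R, s.IsRightCSeq C
  of_iso : ∀ s t : RightSeq S, s.Isomorphic t → s ∈ R → t ∈ R
  sum_mem : ∀ s ∈ R, ∀ t ∈ R, s.sum t ∈ R
  exists_triangle : ∀ A : 𝓐, C A → ∃ (M U : 𝓐) (i : A ⟶ M) (p : M ⟶ U) (q : U ⟶ S.obj A),
    RightSeq.mk A M U i p q ∈ R ∧ IsPreenvelope X i
  graph_mem : ∀ (A B : 𝓐), C A → C B → ∀ f : A ⟶ B,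
    RightSeq.mk A (A ⊞ B) B (biprod.lift (𝟙 A) f) (biprod.desc f (-𝟙 B)) 0 ∈ R
  exists_cone : ∀ s ∈ R, C s.X → IsPreenvelope X s.f → ∀ B : 𝓐, C B → ∀ f : s.X ⟶ B,
    ∃ (N : 𝓐) (g : s.Y ⊞ B ⟶ N) (h : N ⟶ S.obj s.X),
      RightSeq.mk s.X (s.Y ⊞ B) N (biprod.lift s.f f) g h ∈ R
  factor : ∀ s ∈ R, ∀ t ∈ R, X t.Y →
    ∀ (α : s.X ⟶ t.X) (β : s.Y ⟶ t.Y) (γ : s.Z ⟶ t.Z),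
      s.f ≫ β = α ≫ t.f → s.g ≫ γ = β ≫ t.g → s.h ≫ S.map α = γ ≫ t.h →
      (∃ k : s.Y ⟶ t.X, s.f ≫ k = α) → ∃ l : s.Z ⟶ t.Y, l ≫ t.g = γ
  fill : ∀ s ∈ R, ∀ t ∈ R, ∀ (α : s.X ⟶ t.X) (β : s.Y ⟶ t.Y), s.f ≫ β = α ≫ t.f →
    ∃ γ : s.Z ⟶ t.Z, s.g ≫ γ = β ≫ t.g ∧ s.h ≫ S.map α = γ ≫ t.h
  octahedral : ∀ (A B D C' A' B' : 𝓐) (f : A ⟶ B) (l : B ⟶ C') (m : C' ⟶ S.obj A)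
    (g : B ⟶ D) (h : D ⟶ A') (j : A' ⟶ S.obj B) (a : D ⟶ B') (b : B' ⟶ S.obj A),
    C A → C B → C D → IsMonic X f → IsMonic X g →
    RightSeq.mk A B C' f l m ∈ R → RightSeq.mk B D A' g h j ∈ R →
    RightSeq.mk A D B' (f ≫ g) a b ∈ R →
    ∃ (r : C' ⟶ B') (s : B' ⟶ A'),
      l ≫ r = g ≫ a ∧ m = r ≫ b ∧ a ≫ s = h ∧ s ≫ j = b ≫ S.map f ∧
      RightSeq.mk C' B' A' r s (j ≫ S.map l) ∈ R ∧ IsMonic X r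

/-- The quadruple `(𝓐, O, L, X)`, with `L` a class of left `F`-sequences (the left `F`-triangles),
is a partial left triangulated category. This is the dual notion. -/
def IsPartialLeft (O : 𝓐 ⥤ 𝓐) (L : Set (LeftSeq O)) (F X : ObjectProperty 𝓐) : Prop :=
  IsPartialRight (𝓐 := 𝓐ᵒᵖ) O.op {s | LeftSeq.ofOp s ∈ L} F.op X.op

/-! ### The right triangles of `C/X` -/

/-- A right triangle `A ⟶ M ⟶ U ⟶ S A` in `R` whose first morphism is a `P`-preenvelope. -/
structure PreenvelopeTriangle {S : 𝓐 ⥤ 𝓐} (R : Set (RightSeq S)) (P : ObjectProperty 𝓐)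
    (A : 𝓐) where
  M : 𝓐
  U : 𝓐
  i : A ⟶ M
  p : M ⟶ U
  q : U ⟶ S.obj A
  mem : RightSeq.mk A M U i p q ∈ R
  preenvelope : IsPreenvelope P i

theorem FactorsThrough.add {X : ObjectProperty 𝓐} (hX : IsAdditiveSubcategory X) {A B : 𝓐}
    {f g : A ⟶ B} (hf : FactorsThrough X f) (hg : FactorsThrough X g) :
    FactorsThrough X (f + g) := by
  obtain ⟨Z, hZ, a, b, rfl⟩ := hf
  obtain ⟨Z', hZ', a', b', rfl⟩ := hg
  exact ⟨Z ⊞ Z', hX.biprod _ _ hZ hZ', biprod.lift a a', biprod.desc b b', by simp⟩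

namespace IsPartialRight

variable {S : 𝓐 ⥤ 𝓐} {R : Set (RightSeq S)} {C X : ObjectProperty 𝓐}

theorem exists_suspMap (h : IsPartialRight S R C X) {A B : 𝓐} (eA : PreenvelopeTriangle R X A)
    (eB : PreenvelopeTriangle R X B) (f : A ⟶ B) :
    ∃ κ : eA.U ⟶ eB.U, ∃ σ : eA.M ⟶ eB.M,
      eA.i ≫ σ = f ≫ eB.i ∧ eA.p ≫ κ = σ ≫ eB.p ∧ eA.q ≫ S.map f = κ ≫ eB.q := by
  obtain ⟨σ, hσ⟩ := eA.preenvelope.2 _ eB.preenvelope.1 (f ≫ eB.i)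
  obtain ⟨κ, h1, h2⟩ := h.fill _ eA.mem _ eB.mem f σ hσ
  exact ⟨κ, σ, hσ, h1, h2⟩

/-- The morphism `κ` induced by `f` on the third terms of the chosen triangles. -/
noncomputable def suspMap (h : IsPartialRight S R C X) {A B : 𝓐} (eA : PreenvelopeTriangle R X A)
    (eB : PreenvelopeTriangle R X B) (f : A ⟶ B) : eA.U ⟶ eB.U :=
  (h.exists_suspMap eA eB f).choose

theorem suspMap_spec (h : IsPartialRight S R C X) {A B : 𝓐} (eA : PreenvelopeTriangle R X A)
    (eB : PreenvelopeTriangle R X B) (f : A ⟶ B) : ∃ σ : eA.M ⟶ eB.M,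
      eA.i ≫ σ = f ≫ eB.i ∧ eA.p ≫ h.suspMap eA eB f = σ ≫ eB.p ∧
        eA.q ≫ S.map f = h.suspMap eA eB f ≫ eB.q :=
  (h.exists_suspMap eA eB f).choose_spec

theorem susp_unique (h : IsPartialRight S R C X) {A B : 𝓐} (eA : PreenvelopeTriangle R X A)
    (eB : PreenvelopeTriangle R X B) {f f' : A ⟶ B} (hf : FactorsThrough X (f - f'))
    {κ κ' : eA.U ⟶ eB.U} {σ σ' : eA.M ⟶ eB.M}
    (h1 : eA.i ≫ σ = f ≫ eB.i) (h2 : eA.p ≫ κ = σ ≫ eB.p) (h3 : eA.q ≫ S.map f = κ ≫ eB.q)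
    (h1' : eA.i ≫ σ' = f' ≫ eB.i) (h2' : eA.p ≫ κ' = σ' ≫ eB.p)
    (h3' : eA.q ≫ S.map f' = κ' ≫ eB.q) : FactorsThrough X (κ - κ') := by
  have := h.functor_additive
  obtain ⟨Z, hZ, a, b, hab⟩ := hf
  obtain ⟨a', ha'⟩ := eA.preenvelope.2 _ hZ a
  obtain ⟨l, hl⟩ := h.factor _ eA.mem _ eB.mem eB.preenvelope.1 (f - f') (σ - σ') (κ - κ')
    (by simp [h1, h1']) (by simp [h2, h2']) (by simp [h3, h3', Functor.map_sub])
    ⟨a' ≫ b, by simp [← hab, ← ha']⟩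
  exact ⟨eB.M, eB.preenvelope.1, l, eB.p, hl⟩

theorem U_mem (h : IsPartialRight S R C X) {P : ObjectProperty 𝓐} {A : 𝓐}
    (e : PreenvelopeTriangle R P A) : C e.U :=
  (h.isRightCSeq _ e.mem).1

/-- The suspension functor of `C/X` attached to a choice of a right triangle
`A ⟶ X^A ⟶ U^A ⟶ S A` with `A ⟶ X^A` an `X`-preenvelope, for each `A` in `C`: it sends `A` to `U^A`
and the class of `f` to the class of an induced morphism `κ`. -/
noncomputable def susp (h : IsPartialRight S R C X)
    (e : ∀ A : C.FullSubcategory, PreenvelopeTriangle R X A.obj) :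
    StableCat C X ⥤ StableCat C X :=
  CategoryTheory.Quotient.lift (StableRel C X)
    { obj := fun A => (toStable C X).obj ⟨(e A).U, h.U_mem (e A)⟩
      map := fun {A B} f => (toStable C X).map
        (ObjectProperty.homMk (h.suspMap (e A) (e B) f.hom))
      map_id := fun A => by
        rw [← (toStable C X).map_id]
        apply CategoryTheory.Quotient.sound
        obtain ⟨σ, h1, h2, h3⟩ := h.suspMap_spec (e A) (e A) (𝟙 A.obj)
        exact h.susp_unique (e A) (e A) (f := 𝟙 A.obj) (f' := 𝟙 A.obj) (σ' := 𝟙 _) (κ' := 𝟙 _)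
          ⟨(e A).M, (e A).preenvelope.1, 0, 0, by simp⟩ h1 h2 h3 (by simp) (by simp) (by simp)
      map_comp := fun {A B D} f g => by
        rw [← (toStable C X).map_comp]
        apply CategoryTheory.Quotient.sound
        obtain ⟨σ, h1, h2, h3⟩ := h.suspMap_spec (e A) (e D) (f ≫ g).hom
        obtain ⟨σ', h1', h2', h3'⟩ := h.suspMap_spec (e A) (e B) f.hom
        obtain ⟨σ'', h1'', h2'', h3''⟩ := h.suspMap_spec (e B) (e D) g.hom
        refine h.susp_unique (e A) (e D) (f := (f ≫ g).hom) (f' := f.hom ≫ g.hom) (σ' := σ' ≫ σ'')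
          ⟨(e A).M, (e A).preenvelope.1, 0, 0, by simp⟩ h1 h2 h3 ?_ ?_ ?_
        · rw [reassoc_of% h1', h1'', Category.assoc]
        · simp only [ObjectProperty.FullSubcategory.comp_hom, ObjectProperty.homMk_hom]
          rw [reassoc_of% h2', h2'', Category.assoc]
        · simp only [ObjectProperty.FullSubcategory.comp_hom, ObjectProperty.homMk_hom]
          rw [Functor.map_comp, reassoc_of% h3', h3'', Category.assoc] }
    (fun A B f f' hf => by
      apply CategoryTheory.Quotient.sound
      obtain ⟨σ, h1, h2, h3⟩ := h.suspMap_spec (e A) (e B) f.hom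
      obtain ⟨σ', h1', h2', h3'⟩ := h.suspMap_spec (e A) (e B) f'.hom
      exact h.susp_unique (e A) (e B) hf h1 h2 h3 h1' h2' h3')

/-- A standard right triangle of `C/X`: the sequence of the classes of `f`, `g`, `ξ`, where
`A ⟶ B ⟶ D ⟶ S A` is a right `C`-triangle with `A`, `B` in `C` and `f` an `X`-monic, and `ξ` is part
of a morphism, with identity first component, to the chosen triangle of `A`. -/
inductive IsStandard (h : IsPartialRight S R C X)
    (e : ∀ A : C.FullSubcategory, PreenvelopeTriangle R X A.obj) : RightSeq (h.susp e) → Prop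
  | mk (A B D : C.FullSubcategory) (f : A ⟶ B) (g : B ⟶ D) (k : D.obj ⟶ S.obj A.obj)
      (mem : RightSeq.mk A.obj B.obj D.obj f.hom g.hom k ∈ R) (monic : IsMonic X f.hom)
      (δ : B.obj ⟶ (e A).M) (ξ : D.obj ⟶ (e A).U)
      (h1 : f.hom ≫ δ = (e A).i) (h2 : g.hom ≫ ξ = δ ≫ (e A).p) (h3 : ξ ≫ (e A).q = k) :
      IsStandard h e
        { X := (toStable C X).obj A
          Y := (toStable C X).obj B
          Z := (toStable C X).obj D
          f := (toStable C X).map f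
          g := (toStable C X).map g
          h := (toStable C X).map (Y := ⟨(e A).U, h.U_mem (e A)⟩) (ObjectProperty.homMk ξ) }

/-- A distinguished right triangle of `C/X`: a sequence isomorphic to a standard one. -/
def IsDistinguished (h : IsPartialRight S R C X)
    (e : ∀ A : C.FullSubcategory, PreenvelopeTriangle R X A.obj) (s : RightSeq (h.susp e)) : Prop :=
  ∃ t : RightSeq (h.susp e), h.IsStandard e t ∧ s.Isomorphic t

/-! ### Stabilizing subcategories -/

end IsPartialRight

/-- A right triangle `A ⟶ R(A) ⟶ W ⟶ S A` in `R` whose first morphism is a `G`-preenvelope and such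
that all morphisms from `W` to `G` vanish modulo `X`. -/
structure SpecialTriangle {S : 𝓐 ⥤ 𝓐} (R : Set (RightSeq S)) (X G : ObjectProperty 𝓐)
    (A : 𝓐) extends PreenvelopeTriangle R G A where
  perp : LeftPerp X G U

/-- `G` is a special preenveloping subcategory of `C` in `(𝓐, S, R, X)`. -/
structure IsSpecialPreenveloping (S : 𝓐 ⥤ 𝓐) (R : Set (RightSeq S)) (C X G : ObjectProperty 𝓐) :
    Prop where
  additive : IsAdditiveSubcategory G
  X_le : X ≤ G
  le_C : G ≤ C
  exists_triangle : ∀ A : 𝓐, C A → Nonempty (SpecialTriangle R X G A)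

namespace IsPartialRight

variable {S : 𝓐 ⥤ 𝓐} {R : Set (RightSeq S)} {C X G : ObjectProperty 𝓐}

theorem exists_replMap {A B : 𝓐} (jA : SpecialTriangle R X G A)
    (jB : SpecialTriangle R X G B) (f : A ⟶ B) :
    ∃ k : jA.M ⟶ jB.M, jA.i ≫ k = f ≫ jB.i :=
  jA.preenvelope.2 _ jB.preenvelope.1 (f ≫ jB.i)

theorem repl_unique (h : IsPartialRight S R C X) (hG : IsSpecialPreenveloping S R C X G)
    {A B : 𝓐} (jA : SpecialTriangle R X G A) (jB : SpecialTriangle R X G B) {f f' : A ⟶ B}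
    (hf : FactorsThrough X (f - f')) {k k' : jA.M ⟶ jB.M} (hk : jA.i ≫ k = f ≫ jB.i)
    (hk' : jA.i ≫ k' = f' ≫ jB.i) : FactorsThrough X (k - k') := by
  obtain ⟨Z, hZ, a, b, hab⟩ := hf
  obtain ⟨a', ha'⟩ := jA.preenvelope.2 _ (hG.X_le _ hZ) a
  obtain ⟨l, hl⟩ := (h.isRightCSeq _ jA.mem).2.1.2 _ (k - k' - a' ≫ b ≫ jB.i) (by
    simp only [Preadditive.comp_sub, hk, hk', reassoc_of% ha', reassoc_of% hab]
    simp)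
  dsimp only at hl
  have h1 : k - k' = a' ≫ b ≫ jB.i + jA.p ≫ l := by rw [hl]; abel
  rw [h1]
  refine FactorsThrough.add h.additive_X ⟨Z, hZ, a', b ≫ jB.i, rfl⟩ ?_
  obtain ⟨Z', hZ', c, d, rfl⟩ := jA.perp _ jB.preenvelope.1 l
  exact ⟨Z', hZ', jA.p ≫ c, d, by simp⟩

/-- The functor `C/X ⥤ G/X` attached to a choice of special triangles `A ⟶ R(A) ⟶ W^A ⟶ S A`: it
sends `A` to `R(A)` and the class of `f` to the class of a morphism `R(A) ⟶ R(B)` that extends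
`f`. -/
noncomputable def repl (h : IsPartialRight S R C X) (hG : IsSpecialPreenveloping S R C X G)
    (j : ∀ A : C.FullSubcategory, SpecialTriangle R X G A.obj) :
    StableCat C X ⥤ StableCat G X :=
  CategoryTheory.Quotient.lift (StableRel C X)
    { obj := fun A => (toStable G X).obj ⟨(j A).M, (j A).preenvelope.1⟩
      map := fun {A B} f => (toStable G X).map
        (ObjectProperty.homMk (exists_replMap (j A) (j B) f.hom).choose)
      map_id := fun A => by
        rw [← (toStable G X).map_id]
        apply CategoryTheory.Quotient.sound
        refine h.repl_unique hG (j A) (j A) (f := 𝟙 A.obj) (f' := 𝟙 A.obj) ?_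
          (exists_replMap (j A) (j A) (𝟙 A.obj)).choose_spec (k' := 𝟙 _) (by simp)
        obtain ⟨M, _, _, _, _, _, hM⟩ := h.exists_triangle _ A.property
        exact ⟨M, hM.1, 0, 0, by simp⟩
      map_comp := fun {A B D} f g => by
        rw [← (toStable G X).map_comp]
        apply CategoryTheory.Quotient.sound
        refine h.repl_unique hG (j A) (j D) (f := (f ≫ g).hom) (f' := f.hom ≫ g.hom) ?_
          (exists_replMap (j A) (j D) (f ≫ g).hom).choose_spec ?_
        · obtain ⟨M, _, _, _, _, _, hM⟩ := h.exists_triangle _ A.property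
          exact ⟨M, hM.1, 0, 0, by simp⟩
        · have h1 := (exists_replMap (j A) (j B) f.hom).choose_spec
          have h2 := (exists_replMap (j B) (j D) g.hom).choose_spec
          simp only [ObjectProperty.FullSubcategory.comp_hom, ObjectProperty.homMk_hom]
          rw [reassoc_of% h1, h2, Category.assoc] }
    (fun A B f f' hf => by
      apply CategoryTheory.Quotient.sound
      exact h.repl_unique hG (j A) (j B) hf (exists_replMap (j A) (j B) f.hom).choose_spec
        (exists_replMap (j A) (j B) f'.hom).choose_spec)

end IsPartialRight

/-- `R(A)` as an object of `C`, for a special preenveloping subcategory of `C`. -/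
def SpecialTriangle.target {S : 𝓐 ⥤ 𝓐} {R : Set (RightSeq S)} {C X G : ObjectProperty 𝓐}
    (hG : IsSpecialPreenveloping S R C X G) {A : 𝓐} (j : SpecialTriangle R X G A) :
    C.FullSubcategory :=
  ⟨j.M, hG.le_C _ j.preenvelope.1⟩

/-- The preenvelope `A ⟶ R(A)` as a morphism of `C`. -/
def SpecialTriangle.hom {S : 𝓐 ⥤ 𝓐} {R : Set (RightSeq S)} {C X G : ObjectProperty 𝓐}
    (hG : IsSpecialPreenveloping S R C X G) {A : C.FullSubcategory}
    (j : SpecialTriangle R X G A.obj) : A ⟶ j.target hG :=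
  ObjectProperty.homMk (Y := j.target hG) j.i

/-- `G` is a stabilizing subcategory of the partial right triangulated category `(𝓐, S, R, X)`. The
condition is required for every choice `e`, `j` of the triangles that define the suspension of
`C/X` and the functor `C/X ⥤ G/X`; such choices exist. -/
structure IsStabilizing {S : 𝓐 ⥤ 𝓐} {R : Set (RightSeq S)} {C X : ObjectProperty 𝓐}
    (h : IsPartialRight S R C X) (G : ObjectProperty 𝓐) : Prop where
  special : IsSpecialPreenveloping S R C X G
  exists_map : ∀ (e : ∀ A : C.FullSubcategory, PreenvelopeTriangle R X A.obj)
    (j : ∀ A : C.FullSubcategory, SpecialTriangle R X G A.obj)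
    (A B : C.FullSubcategory) (f : A ⟶ B)
    (f' : (j A).target special ⟶ (j B).target special),
    (j A).hom special ≫ f' = f ≫ (j B).hom special →
    ∀ (D D' : StableCat C X)
      (g : (toStable C X).obj B ⟶ D) (k : D ⟶ (h.susp e).obj ((toStable C X).obj A))
      (g' : (toStable C X).obj ((j B).target special) ⟶ D')
      (k' : D' ⟶ (h.susp e).obj ((toStable C X).obj ((j A).target special))),
      h.IsDistinguished e ⟨_, _, D, (toStable C X).map f, g, k⟩ →
      h.IsDistinguished e ⟨_, _, D', (toStable C X).map f', g', k'⟩ →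
      ∃ t : D ⟶ D', g ≫ t = (toStable C X).map ((j B).hom special) ≫ g' ∧
        k ≫ (h.susp e).map ((toStable C X).map ((j A).hom special)) = t ≫ k' ∧
        IsIso ((h.repl special j).map t)

/-- `G` is a stabilizing subcategory of the partial left triangulated category `(𝓐, O, L, X)`. This
is the dual notion. -/
def IsStabilizingLeft {O : 𝓐 ⥤ 𝓐} {L : Set (LeftSeq O)} {F X : ObjectProperty 𝓐}
    (h : IsPartialLeft O L F X) (G : ObjectProperty 𝓐) : Prop :=
  IsStabilizing (𝓐 := 𝓐ᵒᵖ) (S := O.op) (R := {s | LeftSeq.ofOp s ∈ L}) (C := F.op) (X := X.op)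
    h G.op

/-! ### Pre-partial triangulated categories -/

section Compatibility

variable {O S : 𝓐 ⥤ 𝓐} (ψ : O ⊣ S) (L : Set (LeftSeq O)) (R : Set (RightSeq S))
  (C F X : ObjectProperty 𝓐)

/-- The identity `u ∘ O(γ) = - α ∘ ψ⁻¹(h)`, for `α : A ⟶ L` and `γ : C ⟶ N`. -/
def LeftCompatible (s : RightSeq S) (t : LeftSeq O) (α : s.X ⟶ t.L) (γ : s.Z ⟶ t.N) : Prop :=
  O.map γ ≫ t.u = -((ψ.homEquiv s.Z s.X).symm s.h ≫ α)

/-- The identity `S(α) ∘ h = - ψ(u) ∘ γ`, for `α : A ⟶ L` and `γ : C ⟶ N`. -/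
def RightCompatible (s : RightSeq S) (t : LeftSeq O) (α : s.X ⟶ t.L) (γ : s.Z ⟶ t.N) : Prop :=
  s.h ≫ S.map α = -(γ ≫ ψ.homEquiv t.N t.L t.u)

/-- The conditions on a pre-partial triangulated category that involve both classes of triangles
and the adjunction `ψ`. Those on the chosen triangles are required for every possible choice. -/
structure AreCompatible : Prop where
  fill_left : ∀ s ∈ R, ∀ t ∈ L, IsMonic X s.f → IsEpic X t.w → ∀ (β : s.Y ⟶ t.M) (γ : s.Z ⟶ t.N),
    s.g ≫ γ = β ≫ t.w → ∃ α : s.X ⟶ t.L, α ≫ t.v = s.f ≫ β ∧ LeftCompatible ψ s t α γ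
  fill_right : ∀ s ∈ R, ∀ t ∈ L, IsMonic X s.f → IsEpic X t.w → ∀ (β : s.Y ⟶ t.M) (α : s.X ⟶ t.L),
    α ≫ t.v = s.f ≫ β → ∃ γ : s.Z ⟶ t.N, s.g ≫ γ = β ≫ t.w ∧ RightCompatible ψ s t α γ
  factor_left : ∀ s ∈ R, ∀ t ∈ L, (C ⊓ F) s.X → IsPreenvelope X s.f → IsEpic X t.w →
    ∀ (α : s.X ⟶ t.L) (β : s.Y ⟶ t.M) (γ : s.Z ⟶ t.N),
      s.f ≫ β = α ≫ t.v → s.g ≫ γ = β ≫ t.w → LeftCompatible ψ s t α γ →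
      (∃ a : s.Z ⟶ t.M, a ≫ t.w = γ) → ∃ b : s.Y ⟶ t.L, s.f ≫ b = α
  factor_right : ∀ s ∈ R, ∀ t ∈ L, (C ⊓ F) t.N → IsPrecover X t.w → IsMonic X s.f →
    ∀ (α : s.X ⟶ t.L) (β : s.Y ⟶ t.M) (γ : s.Z ⟶ t.N),
      s.f ≫ β = α ≫ t.v → s.g ≫ γ = β ≫ t.w → RightCompatible ψ s t α γ →
      (∃ b : s.Y ⟶ t.L, s.f ≫ b = α) → ∃ a : s.Z ⟶ t.M, a ≫ t.w = γ

end Compatibility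

/-- `(𝓐, O, S, L, R, X)` is a pre-partial triangulated category, where `L` is a class of left
`F`-triangles and `R` a class of right `C`-triangles. -/
structure IsPrePartialTriangulated (O S : 𝓐 ⥤ 𝓐) (L : Set (LeftSeq O)) (R : Set (RightSeq S))
    (C F X : ObjectProperty 𝓐) : Prop where
  right : IsPartialRight S R C X
  left : IsPartialLeft O L F X
  stabilizing_right : IsStabilizing right (C ⊓ F)
  stabilizing_left : IsStabilizingLeft left (C ⊓ F)
  exists_adjunction : ∃ ψ : O ⊣ S, AreCompatible ψ L R C F X

/-! ### Localization triples -/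

/-- `(C, X, D)` is a localization triple of `𝓐`. -/
structure IsLocalizationTriple (C X D : ObjectProperty 𝓐) : Prop where
  additive_C : IsAdditiveSubcategory C
  additive_X : IsAdditiveSubcategory X
  additive_D : IsAdditiveSubcategory D
  X_le : X ≤ C ⊓ D
  exists_precover : ∀ A : 𝓐, ∃ (W Q : 𝓐) (ω : W ⟶ Q) (r : Q ⟶ A),
    IsPrecover C r ∧ IsWeakKernel ω r ∧ RightPerp C X W ∧ (D A → (C ⊓ D) Q)
  exists_preenvelope : ∀ A : 𝓐, ∃ (R W : 𝓐) (j : A ⟶ R) (τ : R ⟶ W),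
    IsPreenvelope D j ∧ IsWeakCokernel j τ ∧ LeftPerp X D W ∧ (C A → (C ⊓ D) R)

end Partial

/-! ### Exact categories and Hovey triples -/

section Exact

variable {𝓐 : Type u} [Category.{v} 𝓐] [Preadditive 𝓐]

/-- `i` is an inflation for the class `E` of conflations. -/
def IsInflation (E : ObjectProperty (ShortComplex 𝓐)) {A B : 𝓐} (i : A ⟶ B) : Prop :=
  ∃ (D : 𝓐) (d : B ⟶ D) (w : i ≫ d = 0), E (ShortComplex.mk i d w)

/-- `d` is a deflation for the class `E` of conflations. -/
def IsDeflation (E : ObjectProperty (ShortComplex 𝓐)) {B D : 𝓐} (d : B ⟶ D) : Prop :=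
  ∃ (A : 𝓐) (i : A ⟶ B) (w : i ≫ d = 0), E (ShortComplex.mk i d w)

/-- `E` is an exact structure (in the sense of Quillen and Keller) on the additive category `𝓐`. -/
structure IsExactStructure [HasZeroObject 𝓐] (E : ObjectProperty (ShortComplex 𝓐)) : Prop where
  isKernel : ∀ s : ShortComplex 𝓐, E s → Nonempty (IsLimit (KernelFork.ofι s.f s.zero))
  isCokernel : ∀ s : ShortComplex 𝓐, E s → Nonempty (IsColimit (CokernelCofork.ofπ s.g s.zero))
  of_iso : ∀ s t : ShortComplex 𝓐, (s ≅ t) → E s → E t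
  zero : IsInflation E (𝟙 (0 : 𝓐))
  deflation_comp : ∀ {A B D : 𝓐} (f : A ⟶ B) (g : B ⟶ D),
    IsDeflation E f → IsDeflation E g → IsDeflation E (f ≫ g)
  inflation_comp : ∀ {A B D : 𝓐} (f : A ⟶ B) (g : B ⟶ D),
    IsInflation E f → IsInflation E g → IsInflation E (f ≫ g)
  pullback : ∀ {A B B' : 𝓐} (d : A ⟶ B) (f : B' ⟶ B), IsDeflation E d →
    ∃ (A' : 𝓐) (f' : A' ⟶ A) (d' : A' ⟶ B'), IsPullback f' d' d f ∧ IsDeflation E d'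
  pushout : ∀ {D D' B : 𝓐} (i : D ⟶ B) (g : D ⟶ D'), IsInflation E i →
    ∃ (B' : 𝓐) (g' : B ⟶ B') (i' : D' ⟶ B'), IsPushout i g g' i' ∧ IsInflation E i'

/-- A conflation `A ⟶ mid ⟶ D`. -/
structure Extension (E : ObjectProperty (ShortComplex 𝓐)) (D A : 𝓐) where
  mid : 𝓐
  i : A ⟶ mid
  d : mid ⟶ D
  w : i ≫ d = 0
  mem : E (ShortComplex.mk i d w)

/-- Equivalence of conflations with the same end terms. -/
instance Extension.setoid (E : ObjectProperty (ShortComplex 𝓐)) (D A : 𝓐) :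
    Setoid (Extension E D A) where
  r s t := ∃ e : s.mid ≅ t.mid, s.i ≫ e.hom = t.i ∧ e.hom ≫ t.d = s.d
  iseqv :=
    { refl := fun s => ⟨Iso.refl _, by simp, by simp⟩
      symm := by
        rintro s t ⟨e, h1, h2⟩
        exact ⟨e.symm, by simp [← h1], by simp [← h2]⟩
      trans := by
        rintro s t r ⟨e, h1, h2⟩ ⟨e', h1', h2'⟩
        exact ⟨e ≪≫ e', by simp [reassoc_of% h1, h1'], by simp [h2, h2']⟩ }

/-- The set `Ext¹(D, A)` of equivalence classes of conflations `A ⟶ B ⟶ D`. For an exact structure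
it is nonempty, since it contains the class of the split conflation. -/
def Ext1 (E : ObjectProperty (ShortComplex 𝓐)) (D A : 𝓐) : Type (max u v) :=
  _root_.Quotient (Extension.setoid E D A)

/-- `Ext¹(D, A) = 0`. -/
def Ext1IsZero (E : ObjectProperty (ShortComplex 𝓐)) (D A : 𝓐) : Prop :=
  Subsingleton (Ext1 E D A)

/-- `(C, F)` is a complete cotorsion pair. -/
structure IsCompleteCotorsionPair (E : ObjectProperty (ShortComplex 𝓐)) (C F : ObjectProperty 𝓐) :
    Prop where
  left_iff : ∀ A : 𝓐, C A ↔ ∀ B : 𝓐, F B → Ext1IsZero E A B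
  right_iff : ∀ B : 𝓐, F B ↔ ∀ A : 𝓐, C A → Ext1IsZero E A B
  enough_projectives : ∀ A : 𝓐, ∃ (K Q : 𝓐) (i : K ⟶ Q) (d : Q ⟶ A) (w : i ≫ d = 0),
    E (ShortComplex.mk i d w) ∧ C Q ∧ F K
  enough_injectives : ∀ A : 𝓐, ∃ (I Q : 𝓐) (i : A ⟶ I) (d : I ⟶ Q) (w : i ≫ d = 0),
    E (ShortComplex.mk i d w) ∧ C Q ∧ F I

variable [HasBinaryBiproducts 𝓐]

/-- `W` is a thick subcategory. -/
structure IsThick (E : ObjectProperty (ShortComplex 𝓐)) (W : ObjectProperty 𝓐) : Prop where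
  of_iso : ∀ A B : 𝓐, (A ≅ B) → W A → W B
  of_summand : ∀ A B : 𝓐, W (A ⊞ B) → W A
  left : ∀ s : ShortComplex 𝓐, E s → W s.X₂ → W s.X₃ → W s.X₁
  middle : ∀ s : ShortComplex 𝓐, E s → W s.X₁ → W s.X₃ → W s.X₂
  right : ∀ s : ShortComplex 𝓐, E s → W s.X₁ → W s.X₂ → W s.X₃

/-- `(C, W, F)` is a Hovey triple. -/
structure IsHoveyTriple (E : ObjectProperty (ShortComplex 𝓐)) (C W F : ObjectProperty 𝓐) :
    Prop where
  thick : IsThick E W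
  pair_left : IsCompleteCotorsionPair E C (W ⊓ F)
  pair_right : IsCompleteCotorsionPair E (C ⊓ W) F

variable [HasZeroObject 𝓐]

/-- The zero endofunctor. -/
noncomputable abbrev zeroFunctor (𝓐 : Type u) [Category.{v} 𝓐] [HasZeroObject 𝓐] : 𝓐 ⥤ 𝓐 :=
  (Functor.const 𝓐).obj 0

/-- The class of right sequences `A ⟶ B ⟶ D ⟶ 0` such that `A ⟶ B ⟶ D` is a conflation with `D`
in `P`. -/
def rightTriangles (E : ObjectProperty (ShortComplex 𝓐)) (P : ObjectProperty 𝓐) :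
    Set (RightSeq (zeroFunctor 𝓐)) :=
  {s | ∃ w : s.f ≫ s.g = 0, E (ShortComplex.mk s.f s.g w) ∧ P s.Z}

/-- The class of left sequences `0 ⟶ K ⟶ A ⟶ B` such that `K ⟶ A ⟶ B` is a conflation with `K`
in `P`. -/
def leftTriangles (E : ObjectProperty (ShortComplex 𝓐)) (P : ObjectProperty 𝓐) :
    Set (LeftSeq (zeroFunctor 𝓐)) :=
  {s | ∃ w : s.v ≫ s.w = 0, E (ShortComplex.mk s.v s.w w) ∧ P s.L}

end Exact

end ExactHomotopy

open ExactHomotopy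

namespace ExactHomotopy

/-! ### Exact categories -/

section ExactStructure

variable {𝓐 : Type u} [Category.{v} 𝓐] [Preadditive 𝓐] {E : ObjectProperty (ShortComplex 𝓐)}

/-! Write `X = C ⊓ W ⊓ F`. A complete cotorsion pair supplies lifts and extensions: when `Ext¹(T,
A)` vanishes, maps from `T` lift along deflations with kernel `A`, and maps to `A` extend along
inflations with cokernel `T`. Moreover a map from `C` to `W ⊓ F`, or from `C ⊓ W` to `F`, factors
through `X` (`factorsThrough_of_right`, `factorsThrough_of_left`). The special approximations of the
two pairs therefore form a localization triple.

The right triangles are the conflations with third term in `C`. With zero suspension every condition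
on the last map is empty, and the axioms reduce to universal properties, closure of `C` under
extensions, pushouts for the cones, and the Noether isomorphism for the octahedron
(`isPartialRight`).

The substantial point is that `C ⊓ F` is stabilizing. Call `t` a weak equivalence if it induces
bijections on maps into every `T` in `F`, modulo `X`. For morphisms of `C`, such a `t` becomes
invertible under the functor `R`, by a Yoneda argument in `C ⊓ F` (`isIso_repl_map`). Special
preenvelopes are weak equivalences (`IsWeakEquiv.of_special`), and if a morphism of conflations with
third terms in `C` has weak equivalences as its first two components, so is the third
(`IsWeakEquiv.third`). This last fact is a five lemma by hand: a deflation `P ⟶ T` with `P` in `X`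
and kernel `K` in `F` makes "zero modulo `X`" mean "lifts to `P`", and the bijections for `T` follow
from those for `T` and `K` on the first two terms. In a square of preenvelopes the map induced on
cokernels is then the required one.

The left-handed half is the right-handed half in the opposite category, where `C` and `F` trade
places. The compatibility conditions use only kernels and cokernels. -/

/-- The class of conflations of the opposite category. -/
def opConflations (E : ObjectProperty (ShortComplex 𝓐)) :
    ObjectProperty (ShortComplex 𝓐ᵒᵖ) := fun s => E s.unop

theorem isInflation_op {A B : 𝓐ᵒᵖ} {f : A ⟶ B} :
    IsInflation (opConflations E) f ↔ IsDeflation E f.unop :=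
  ⟨fun ⟨D, d, w, h⟩ => ⟨D.unop, d.unop, congrArg Quiver.Hom.unop w, h⟩,
    fun ⟨D, d, w, h⟩ => ⟨op D, d.op, congrArg Quiver.Hom.op w, h⟩⟩

theorem isDeflation_op {A B : 𝓐ᵒᵖ} {f : A ⟶ B} :
    IsDeflation (opConflations E) f ↔ IsInflation E f.unop :=
  ⟨fun ⟨D, d, w, h⟩ => ⟨D.unop, d.unop, congrArg Quiver.Hom.unop w, h⟩,
    fun ⟨D, d, w, h⟩ => ⟨op D, d.op, congrArg Quiver.Hom.op w, h⟩⟩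

variable [HasZeroObject 𝓐]

namespace IsExactStructure

theorem mono_f (hE : IsExactStructure E) {A B D : 𝓐} {f : A ⟶ B} {g : B ⟶ D} {w : f ≫ g = 0}
    (h : E (ShortComplex.mk f g w)) : Mono f :=
  Fork.IsLimit.mono (hE.isKernel _ h).some

theorem epi_g (hE : IsExactStructure E) {A B D : 𝓐} {f : A ⟶ B} {g : B ⟶ D} {w : f ≫ g = 0}
    (h : E (ShortComplex.mk f g w)) : Epi g :=
  Cofork.IsColimit.epi (hE.isCokernel _ h).some

theorem exists_lift (hE : IsExactStructure E) {A B D T : 𝓐} {f : A ⟶ B} {g : B ⟶ D}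
    {w : f ≫ g = 0} (h : E (ShortComplex.mk f g w)) (k : T ⟶ B) (hk : k ≫ g = 0) :
    ∃ l : T ⟶ A, l ≫ f = k :=
  ⟨_, (KernelFork.IsLimit.lift' (hE.isKernel _ h).some k hk).2⟩

theorem exists_desc (hE : IsExactStructure E) {A B D T : 𝓐} {f : A ⟶ B} {g : B ⟶ D}
    {w : f ≫ g = 0} (h : E (ShortComplex.mk f g w)) (k : B ⟶ T) (hk : f ≫ k = 0) :
    ∃ l : D ⟶ T, g ≫ l = k :=
  ⟨_, (CokernelCofork.IsColimit.desc' (hE.isCokernel _ h).some k hk).2⟩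

theorem mem_of_iso (hE : IsExactStructure E) {A B D A' B' D' : 𝓐} {f : A ⟶ B} {g : B ⟶ D}
    {w : f ≫ g = 0} (h : E (ShortComplex.mk f g w)) {f' : A' ⟶ B'} {g' : B' ⟶ D'}
    (w' : f' ≫ g' = 0) (a : A ≅ A') (b : B ≅ B') (c : D ≅ D') (h₁ : f ≫ b.hom = a.hom ≫ f')
    (h₂ : g ≫ c.hom = b.hom ≫ g') : E (ShortComplex.mk f' g' w') :=
  hE.of_iso _ _ (ShortComplex.isoMk (S₁ := ShortComplex.mk f g w) (S₂ := ShortComplex.mk f' g' w')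
    a b c h₁.symm h₂.symm) h

/-- Cokernels are unique up to isomorphism, so any cokernel of an inflation completes it to a
conflation. The cokernel property is taken in elementary form, as existence of factorizations and
`Epi g`. -/
theorem mem_of_isInflation (hE : IsExactStructure E) {A B D : 𝓐} {f : A ⟶ B} {g : B ⟶ D}
    (w : f ≫ g = 0) (hf : IsInflation E f) [Epi g]
    (hg : ∀ (T : 𝓐) (k : B ⟶ T), f ≫ k = 0 → ∃ l : D ⟶ T, g ≫ l = k) :
    E (ShortComplex.mk f g w) := by
  obtain ⟨D', d, w', h⟩ := hf
  obtain ⟨u, hu⟩ := hE.exists_desc h g w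
  obtain ⟨v, hv⟩ := hg _ d w'
  have := hE.epi_g h
  let e : D' ≅ D := ⟨u, v, by rw [← cancel_epi d, reassoc_of% hu, hv, Category.comp_id],
    by rw [← cancel_epi g, reassoc_of% hv, hu, Category.comp_id]⟩
  exact hE.mem_of_iso h w (Iso.refl _) (Iso.refl _) e (by simp) (by simp [e, hu])

theorem mem_of_isDeflation (hE : IsExactStructure E) {A B D : 𝓐} {f : A ⟶ B} {g : B ⟶ D}
    (w : f ≫ g = 0) (hg : IsDeflation E g) [Mono f]
    (hf : ∀ (T : 𝓐) (k : T ⟶ B), k ≫ g = 0 → ∃ l : T ⟶ A, l ≫ f = k) :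
    E (ShortComplex.mk f g w) := by
  obtain ⟨D', d, w', h⟩ := hg
  obtain ⟨u, hu⟩ := hE.exists_lift h f w
  obtain ⟨v, hv⟩ := hf _ d w'
  have := hE.mono_f h
  let e : D' ≅ A := ⟨v, u, by rw [← cancel_mono d, Category.assoc, hu, hv, Category.id_comp],
    by rw [← cancel_mono f, Category.assoc, hv, hu, Category.id_comp]⟩
  exact hE.mem_of_iso h w e (Iso.refl _) (Iso.refl _) (by simp [e, hv]) (by simp)

theorem mem_zero (hE : IsExactStructure E) {s : ShortComplex 𝓐} (h₁ : IsZero s.X₁)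
    (h₂ : IsZero s.X₂) (h₃ : IsZero s.X₃) : E s := by
  obtain ⟨D, d, w, h⟩ := hE.zero
  have := hE.epi_g h
  have hD : IsZero D := (IsZero.iff_id_eq_zero D).2 (by
    rw [← cancel_epi d]
    exact (isZero_zero 𝓐).eq_of_src _ _)
  exact hE.mem_of_iso h s.zero ((isZero_zero 𝓐).iso h₁) ((isZero_zero 𝓐).iso h₂)
    (hD.iso h₃) (h₂.eq_of_tgt _ _) (h₃.eq_of_tgt _ _)

theorem op (hE : IsExactStructure E) : IsExactStructure (opConflations E) where
  isKernel s hs := by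
    have := hE.epi_g (w := s.unop.zero) hs
    have : Mono s.f := inferInstanceAs (Mono s.unop.g.op)
    have key : ∀ {T : 𝓐ᵒᵖ} (k : T ⟶ s.X₂), k ≫ s.g = 0 → ∃ l, l ≫ s.f = k := fun k hk => by
      obtain ⟨l, hl⟩ := hE.exists_desc (w := s.unop.zero) hs k.unop (congrArg Quiver.Hom.unop hk)
      exact ⟨l.op, congrArg Quiver.Hom.op hl⟩
    exact ⟨KernelFork.IsLimit.ofι' s.f s.zero
      fun k hk => ⟨(key k hk).choose, (key k hk).choose_spec⟩⟩
  isCokernel s hs := by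
    have := hE.mono_f (w := s.unop.zero) hs
    have : Epi s.g := inferInstanceAs (Epi s.unop.f.op)
    have key : ∀ {T : 𝓐ᵒᵖ} (k : s.X₂ ⟶ T), s.f ≫ k = 0 → ∃ l, s.g ≫ l = k := fun k hk => by
      obtain ⟨l, hl⟩ := hE.exists_lift (w := s.unop.zero) hs k.unop (congrArg Quiver.Hom.unop hk)
      exact ⟨l.op, congrArg Quiver.Hom.op hl⟩
    exact ⟨CokernelCofork.IsColimit.ofπ' s.g s.zero
      fun k hk => ⟨(key k hk).choose, (key k hk).choose_spec⟩⟩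
  of_iso s t e hs := hE.of_iso s.unop t.unop
    (ShortComplex.isoMk (ShortComplex.π₃.mapIso e).unop.symm (ShortComplex.π₂.mapIso e).unop.symm
      (ShortComplex.π₁.mapIso e).unop.symm
      (congrArg Quiver.Hom.unop e.inv.comm₂₃.symm)
      (congrArg Quiver.Hom.unop e.inv.comm₁₂.symm)) hs
  -- The only axiom not visibly self-dual: it asks for an inflation, while the dual needs a
  -- deflation. The conflation of three zero objects serves both.
  zero := ⟨0, 0, by simp, hE.mem_zero (isZero_zero 𝓐ᵒᵖ).unop (isZero_zero 𝓐ᵒᵖ).unop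
    (isZero_zero 𝓐ᵒᵖ).unop⟩
  deflation_comp f g hf hg := isDeflation_op.2
    (hE.inflation_comp g.unop f.unop (isDeflation_op.1 hg) (isDeflation_op.1 hf))
  inflation_comp f g hf hg := isInflation_op.2
    (hE.deflation_comp g.unop f.unop (isInflation_op.1 hg) (isInflation_op.1 hf))
  pullback d f hd := by
    obtain ⟨A', f', d', h, h'⟩ := hE.pushout d.unop f.unop (isDeflation_op.1 hd)
    exact ⟨_, f'.op, d'.op, h.op.flip, isDeflation_op.2 h'⟩
  pushout i g hi := by
    obtain ⟨A', f', d', h, h'⟩ := hE.pullback i.unop g.unop (isInflation_op.1 hi)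
    exact ⟨_, f'.op, d'.op, h.op.flip, isInflation_op.2 h'⟩

/-- The pullback of a conflation along a morphism to its third term. -/
theorem exists_pullback (hE : IsExactStructure E) {A B D T : 𝓐} {f : A ⟶ B} {g : B ⟶ D}
    {w : f ≫ g = 0} (h : E (ShortComplex.mk f g w)) (k : T ⟶ D) :
    ∃ (P : 𝓐) (p : P ⟶ B) (q : P ⟶ T) (f' : A ⟶ P) (w' : f' ≫ q = 0),
      E (ShortComplex.mk f' q w') ∧ f' ≫ p = f ∧ IsPullback p q g k := by
  obtain ⟨P, p, q, hpb, hq⟩ := hE.pullback g k ⟨_, _, _, h⟩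
  have hf := hE.mono_f h
  obtain ⟨f', h1, h2⟩ : ∃ f' : A ⟶ P, f' ≫ p = f ∧ f' ≫ q = 0 :=
    ⟨hpb.lift f 0 (by simp [w]), by simp, by simp⟩
  have : Mono f' := by
    rw [← h1] at hf
    exact mono_of_mono f' p
  refine ⟨P, p, q, f', h2, hE.mem_of_isDeflation _ hq fun T k hk => ?_, h1, hpb⟩
  obtain ⟨l, hl⟩ := hE.exists_lift h (k ≫ p) (by rw [Category.assoc, hpb.w, reassoc_of% hk, zero_comp])
  exact ⟨l, hpb.hom_ext (by rw [Category.assoc, h1, hl]) (by rw [Category.assoc, h2, hk, comp_zero])⟩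

/-- The pushout of a conflation along a morphism from its first term. -/
theorem exists_pushout (hE : IsExactStructure E) {A B D T : 𝓐} {f : A ⟶ B} {g : B ⟶ D}
    {w : f ≫ g = 0} (h : E (ShortComplex.mk f g w)) (k : A ⟶ T) :
    ∃ (P : 𝓐) (p : B ⟶ P) (q : T ⟶ P) (g' : P ⟶ D) (w' : q ≫ g' = 0),
      E (ShortComplex.mk q g' w') ∧ p ≫ g' = g ∧ IsPushout f k p q := by
  obtain ⟨P, p, q, f', w', h1, h2, h3⟩ := hE.op.exists_pullback (f := g.op) (g := f.op)
    (w := congrArg Quiver.Hom.op w) h k.op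
  exact ⟨P.unop, p.unop, q.unop, f'.unop, congrArg Quiver.Hom.unop w', h1,
    congrArg Quiver.Hom.unop h2, h3.unop.flip⟩

/-- This is the pullback of the zero conflation along `A ⟶ Z`. -/
theorem zero_id (hE : IsExactStructure E) {Z : 𝓐} (hZ : IsZero Z) (A : 𝓐) :
    E (ShortComplex.mk (0 : Z ⟶ A) (𝟙 A) (by simp)) := by
  have h0 : E (ShortComplex.mk (0 : Z ⟶ Z) (0 : Z ⟶ Z) (by simp)) := hE.mem_zero hZ hZ hZ
  obtain ⟨P, p, q, f', w', h, -, hpb⟩ := hE.exists_pullback h0 (0 : A ⟶ Z)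
  have := hE.mono_f h
  let e : P ≅ A := ⟨q, hpb.lift 0 (𝟙 A) (by simp), hpb.hom_ext (hZ.eq_of_tgt _ _) (by simp), by simp⟩
  exact hE.mem_of_iso h _ (Iso.refl _) e (Iso.refl _) (hZ.eq_of_src _ _) (by simp [e])

theorem id_zero (hE : IsExactStructure E) {Z : 𝓐} (hZ : IsZero Z) (A : 𝓐) :
    E (ShortComplex.mk (𝟙 A) (0 : A ⟶ Z) (by simp)) :=
  hE.op.zero_id (Z := Opposite.op Z) hZ.op (Opposite.op A)

/-- The Noether isomorphism for the kernels of two composable deflations. -/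
theorem comp_deflation (hE : IsExactStructure E) {A B D K T P : 𝓐} {f : A ⟶ B} {g : B ⟶ D}
    {w : f ≫ g = 0} (h : E (ShortComplex.mk f g w)) {k : K ⟶ D} {d : D ⟶ T} {w' : k ≫ d = 0}
    (h' : E (ShortComplex.mk k d w')) {p : P ⟶ B} {q : P ⟶ K} (hpb : IsPullback p q g k) :
    E (ShortComplex.mk p (g ≫ d) (by rw [reassoc_of% hpb.w, w', comp_zero])) := by
  have := hE.mono_f h'
  have : Mono p := ⟨fun a b hab => hpb.hom_ext hab (by
    rw [← cancel_mono k, Category.assoc, Category.assoc, ← hpb.w, reassoc_of% hab])⟩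
  refine hE.mem_of_isDeflation _ (hE.deflation_comp g d ⟨_, _, _, h⟩ ⟨_, _, _, h'⟩)
    fun T x hx => ?_
  obtain ⟨l, hl⟩ := hE.exists_lift h' (x ≫ g) (by rw [Category.assoc, hx])
  exact ⟨hpb.lift x l hl.symm, by simp⟩

/-- The Noether isomorphism for the cokernels of two composable inflations. -/
theorem comp_inflation (hE : IsExactStructure E) {A B D K T P : 𝓐} {f : A ⟶ B} {g : B ⟶ D}
    {w : f ≫ g = 0} (h : E (ShortComplex.mk f g w)) {k : K ⟶ A} {d : A ⟶ T} {w' : k ≫ d = 0}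
    (h' : E (ShortComplex.mk k d w')) {p : B ⟶ P} {q : T ⟶ P} (hpo : IsPushout f d p q) :
    E (ShortComplex.mk (k ≫ f) p (by rw [Category.assoc, hpo.w, reassoc_of% w', zero_comp])) :=
  hE.op.comp_deflation (f := g.op) (g := f.op) (w := congrArg Quiver.Hom.op w) h
    (k := d.op) (d := k.op) (w' := congrArg Quiver.Hom.op w') h' hpo.op.flip

/-! ### Conflations built from biproducts -/

variable [HasBinaryBiproducts 𝓐]

/-- The biproduct is the pullback of `A ⟶ 0` along `B ⟶ 0`, and `A ⟶ 0` is a deflation with kernel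
`𝟙 A`. -/
theorem inl_snd (hE : IsExactStructure E) (A B : 𝓐) :
    E (ShortComplex.mk (biprod.inl : A ⟶ A ⊞ B) (biprod.snd : A ⊞ B ⟶ B) (by simp)) := by
  obtain ⟨P, p, q, f', w', h, h1, hpb⟩ := hE.exists_pullback (hE.id_zero (isZero_zero 𝓐) A)
    (0 : B ⟶ 0)
  let e : P ≅ A ⊞ B := ⟨biprod.lift p q, hpb.lift biprod.fst biprod.snd (by simp),
    hpb.hom_ext (by simp) (by simp), by ext <;> simp⟩
  exact hE.mem_of_iso h _ (Iso.refl _) e (Iso.refl _) (by ext <;> simp [e, h1, w']) (by simp [e])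

/-- The second map is a composite of the deflations `B ⊞ T ⟶ B ⟶ D`, and its kernel is the preimage
of `A` under the projection, namely `A ⊞ T`. -/
theorem biprod_map_id (hE : IsExactStructure E) {A B D : 𝓐} {f : A ⟶ B} {g : B ⟶ D}
    {w : f ≫ g = 0} (h : E (ShortComplex.mk f g w)) (T : 𝓐) :
    E (ShortComplex.mk (biprod.map f (𝟙 T)) (biprod.fst ≫ g : B ⊞ T ⟶ D) (by simp [w])) := by
  have h' : E (ShortComplex.mk (biprod.inr : T ⟶ B ⊞ T) biprod.fst (by simp)) :=
    hE.mem_of_iso (hE.inl_snd T B) _ (Iso.refl _) (biprod.braiding T B) (Iso.refl _)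
      (by ext <;> simp) (by simp)
  refine hE.comp_deflation h' h (q := biprod.fst) ⟨⟨by simp⟩, ⟨?_⟩⟩
  · have := hE.mono_f h
    exact PullbackCone.IsLimit.mk _ (fun s => biprod.lift s.snd (s.fst ≫ biprod.snd))
      (fun s => by
        ext
        · simp [← s.condition]
        · simp) (by simp) (fun s m h1 h2 => by
        ext
        · simpa using h2
        · simp [← h1])

theorem isInflation_map (hE : IsExactStructure E) {A B A' B' : 𝓐} {f : A ⟶ B} {f' : A' ⟶ B'}
    (h : IsInflation E f) (h' : IsInflation E f') : IsInflation E (biprod.map f f') := by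
  obtain ⟨D, g, w, h⟩ := h
  obtain ⟨D', g', w', h'⟩ := h'
  have h1 : IsInflation E (biprod.map f (𝟙 A')) := ⟨_, _, _, hE.biprod_map_id h A'⟩
  have h2 : IsInflation E (biprod.map (𝟙 B) f') :=
    ⟨D', biprod.snd ≫ g', by simp [w'], hE.mem_of_iso (hE.biprod_map_id h' B) _
      (biprod.braiding A' B) (biprod.braiding B' B) (Iso.refl _) (by ext <;> simp) (by simp)⟩
  have := hE.inflation_comp _ _ h1 h2
  convert this using 1
  ext <;> simp

/-- The direct sum of two conflations. -/
theorem biprod_map (hE : IsExactStructure E) {A B D A' B' D' : 𝓐} {f : A ⟶ B} {g : B ⟶ D}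
    {f' : A' ⟶ B'} {g' : B' ⟶ D'} {w : f ≫ g = 0} {w' : f' ≫ g' = 0}
    (h : E (ShortComplex.mk f g w)) (h' : E (ShortComplex.mk f' g' w')) :
    E (ShortComplex.mk (biprod.map f f') (biprod.map g g') (by ext <;> simp [w, w'])) := by
  have := hE.epi_g h
  have := hE.epi_g h'
  have : Epi (biprod.map g g') := ⟨fun a b hab => by
    ext
    · rw [← cancel_epi g]
      simpa using biprod.inl ≫= hab
    · rw [← cancel_epi g']
      simpa using biprod.inr ≫= hab⟩
  refine hE.mem_of_isInflation _ (hE.isInflation_map ⟨_, _, _, h⟩ ⟨_, _, _, h'⟩) fun T k hk => ?_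
  obtain ⟨l, hl⟩ := hE.exists_desc h (biprod.inl ≫ k) (by simpa using biprod.inl ≫= hk)
  obtain ⟨l', hl'⟩ := hE.exists_desc h' (biprod.inr ≫ k) (by simpa using biprod.inr ≫= hk)
  exact ⟨biprod.desc l l', by ext <;> simp [hl, hl']⟩

/-- The conflation `A ⟶ A ⊞ B ⟶ B` attached to `f : A ⟶ B`. -/
theorem graph (hE : IsExactStructure E) {A B : 𝓐} (f : A ⟶ B) :
    E (ShortComplex.mk (biprod.lift (𝟙 A) f) (biprod.desc f (-𝟙 B)) (by simp)) := by
  -- The involution `(x, y) ↦ (x, f x - y)` carries the split conflation to this one.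
  let a : A ⊞ B ⟶ A ⊞ B := biprod.lift biprod.fst (biprod.desc f (-𝟙 B))
  have ha : a ≫ a = 𝟙 _ := by ext <;> simp [a]
  exact hE.mem_of_iso (hE.inl_snd A B) _ (Iso.refl _) ⟨a, a, ha, ha⟩ (Iso.refl _)
    (by ext <;> simp [a]) (by ext <;> simp [a])

/-- The conflation attached to a pushout of an inflation. -/
theorem of_isPushout (hE : IsExactStructure E) {A B A' P : 𝓐} {f : A ⟶ B} {k : A ⟶ A'}
    {p : B ⟶ P} {q : A' ⟶ P} (hf : IsInflation E f) (hpo : IsPushout f k p q) :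
    E (ShortComplex.mk (biprod.lift f k) (biprod.desc p (-q)) (by simp [hpo.w])) := by
  obtain ⟨D, g, w, h⟩ := hf
  -- The map `(f, k)` is the graph of `k` followed by `f ⊞ 𝟙`, hence an inflation.
  have := hE.inflation_comp _ _ ⟨_, _, _, hE.graph k⟩ ⟨_, _, _, hE.biprod_map_id h A'⟩
  have : IsInflation E (biprod.lift f k) := by
    convert this using 1
    ext <;> simp
  have : Epi (biprod.desc p (-q)) := ⟨fun a b hab => hpo.hom_ext
    (by simpa using biprod.inl ≫= hab) (by simpa using biprod.inr ≫= hab)⟩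
  refine hE.mem_of_isInflation _ ‹_› fun T x hx => ?_
  have hx' : f ≫ biprod.inl ≫ x = k ≫ (-biprod.inr ≫ x) := by
    rw [biprod.lift_eq] at hx
    simpa [add_eq_zero_iff_eq_neg] using hx
  exact ⟨hpo.desc (biprod.inl ≫ x) (-biprod.inr ≫ x) hx', by ext <;> simp⟩

end IsExactStructure

/-! ### Vanishing of `Ext¹` -/

variable {A B D : 𝓐}

/-- A section `s` determines a complementary retraction `r`, so each extension is a biproduct of its
ends. Two extensions are then identified by matching the summands: `r ≫ y.i + x.d ≫ s'`. -/
theorem ext1IsZero_of_exists_section (hE : IsExactStructure E)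
    (H : ∀ (B : 𝓐) (f : A ⟶ B) (g : B ⟶ D) (w : f ≫ g = 0), E (ShortComplex.mk f g w) →
      ∃ s : D ⟶ B, s ≫ g = 𝟙 D) : Ext1IsZero E D A := by
  have H' : ∀ x : Extension E D A, ∃ (s : D ⟶ x.mid) (r : x.mid ⟶ A),
      s ≫ x.d = 𝟙 D ∧ r ≫ x.i = 𝟙 _ - x.d ≫ s ∧ x.i ≫ r = 𝟙 A ∧ s ≫ r = 0 := fun x => by
    obtain ⟨s, hs⟩ := H _ _ _ _ x.mem
    have := hE.mono_f x.mem
    obtain ⟨r, hr⟩ := hE.exists_lift x.mem (𝟙 _ - x.d ≫ s) (by simp [hs])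
    refine ⟨s, r, hs, hr, ?_, ?_⟩
    · rw [← cancel_mono x.i]
      simp [hr, reassoc_of% x.w]
    · rw [← cancel_mono x.i]
      simp [hr, reassoc_of% hs]
  refine ⟨fun x y => Quotient.inductionOn₂ x y fun x y => Quotient.sound ?_⟩
  obtain ⟨s, r, h1, h2, h3, h4⟩ := H' x
  obtain ⟨s', r', h1', h2', h3', h4'⟩ := H' y
  refine ⟨⟨r ≫ y.i + x.d ≫ s', r' ≫ x.i + y.d ≫ s, ?_, ?_⟩, ?_, ?_⟩
  · simp [reassoc_of% y.w, reassoc_of% h1', reassoc_of% h3', reassoc_of% h4', h2]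
  · simp [reassoc_of% x.w, reassoc_of% h1, reassoc_of% h3, reassoc_of% h4, h2']
  · simp [reassoc_of% x.w, reassoc_of% h3]
  · simp [y.w, h1']

theorem ext1IsZero_of_isZero (hE : IsExactStructure E) (hD : IsZero D) : Ext1IsZero E D A :=
  ext1IsZero_of_exists_section hE fun _ _ _ _ _ => ⟨0, hD.eq_of_src _ _⟩

variable [HasBinaryBiproducts 𝓐]

theorem Ext1IsZero.exists_section (hE : IsExactStructure E) (hDA : Ext1IsZero E D A) {f : A ⟶ B}
    {g : B ⟶ D} {w : f ≫ g = 0} (h : E (ShortComplex.mk f g w)) : ∃ s : D ⟶ B, s ≫ g = 𝟙 D := by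
  obtain ⟨e, -, h2⟩ := _root_.Quotient.exact (hDA.elim
    (_root_.Quotient.mk _ ⟨A ⊞ D, biprod.inl, biprod.snd, by simp, hE.inl_snd A D⟩)
    (_root_.Quotient.mk _ ⟨B, f, g, w, h⟩))
  exact ⟨biprod.inr ≫ e.hom, by simp [h2]⟩

theorem Ext1IsZero.exists_retraction (hE : IsExactStructure E) (hDA : Ext1IsZero E D A)
    {f : A ⟶ B} {g : B ⟶ D} {w : f ≫ g = 0} (h : E (ShortComplex.mk f g w)) :
    ∃ r : B ⟶ A, f ≫ r = 𝟙 A := by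
  obtain ⟨s, hs⟩ := hDA.exists_section hE h
  have := hE.mono_f h
  obtain ⟨r, hr⟩ := hE.exists_lift h (𝟙 _ - g ≫ s) (by simp [hs])
  exact ⟨r, by rw [← cancel_mono f]; simp [hr, reassoc_of% w]⟩

/-- Splitting is self-dual: a retraction of the inflation and a section of the deflation determine
each other. -/
theorem ext1IsZero_op_iff (hE : IsExactStructure E) :
    Ext1IsZero (opConflations E) (op A) (op D) ↔ Ext1IsZero E D A := by
  constructor
  · intro H
    refine ext1IsZero_of_exists_section hE fun B f g w h => ?_
    obtain ⟨s, hs⟩ := H.exists_retraction hE.op (f := g.op) (g := f.op)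
      (w := congrArg Quiver.Hom.op w) h
    exact ⟨s.unop, congrArg Quiver.Hom.unop hs⟩
  · intro H
    refine ext1IsZero_of_exists_section hE.op fun B f g w h => ?_
    obtain ⟨s, hs⟩ := H.exists_retraction hE (f := g.unop) (g := f.unop)
      (w := congrArg Quiver.Hom.unop w) h
    exact ⟨s.op, congrArg Quiver.Hom.op hs⟩

/-- If `Ext¹(T, A) = 0`, then `T` is projective relative to deflations with kernel `A`. -/
theorem Ext1IsZero.exists_lift (hE : IsExactStructure E) {T : 𝓐} (hTA : Ext1IsZero E T A)
    {f : A ⟶ B} {g : B ⟶ D} {w : f ≫ g = 0} (h : E (ShortComplex.mk f g w)) (k : T ⟶ D) :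
    ∃ l : T ⟶ B, l ≫ g = k := by
  obtain ⟨P, p, q, f', w', h', -, hpb⟩ := hE.exists_pullback h k
  obtain ⟨s, hs⟩ := hTA.exists_section hE h'
  exact ⟨s ≫ p, by rw [Category.assoc, hpb.w, reassoc_of% hs]⟩

/-- If `Ext¹(D, T) = 0`, then `T` is injective relative to inflations with cokernel `D`. -/
theorem Ext1IsZero.exists_extend (hE : IsExactStructure E) {T : 𝓐} (hDT : Ext1IsZero E D T)
    {f : A ⟶ B} {g : B ⟶ D} {w : f ≫ g = 0} (h : E (ShortComplex.mk f g w)) (k : A ⟶ T) :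
    ∃ l : B ⟶ T, f ≫ l = k := by
  obtain ⟨P, p, q, f', w', h', -, hpo⟩ := hE.exists_pushout h k
  obtain ⟨s, hs⟩ := hDT.exists_retraction hE h'
  exact ⟨p ≫ s, by rw [reassoc_of% hpo.w, hs, Category.comp_id]⟩

/-- This is exactness of `Ext¹(D, T) ⟶ Ext¹(B, T) ⟶ Ext¹(A, T)` in the vanishing case. An extension
of `B` by `T` splits over `A`; the resulting retraction lives on the preimage `P` of `A`. Since `P ⟶
M` is an inflation with cokernel `D`, the retraction extends to `M`. -/
theorem ext1IsZero_middle (hE : IsExactStructure E) {T : 𝓐} {f : A ⟶ B} {g : B ⟶ D}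
    {w : f ≫ g = 0} (h : E (ShortComplex.mk f g w)) (hA : Ext1IsZero E A T)
    (hD : Ext1IsZero E D T) : Ext1IsZero E B T := by
  refine ext1IsZero_of_exists_section hE fun M i d w' h' => ?_
  obtain ⟨P, p, q, i', w'', h'', h1, hpb⟩ := hE.exists_pullback h' f
  obtain ⟨r, hr⟩ := hA.exists_retraction hE h''
  obtain ⟨r', hr'⟩ := hD.exists_extend hE (hE.comp_deflation h' h hpb) r
  have hir : i ≫ r' = 𝟙 T := by rw [← h1, Category.assoc, hr', hr]
  obtain ⟨s, hs⟩ := hE.exists_desc h' (𝟙 M - r' ≫ i) (by simp [reassoc_of% hir])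
  have := hE.epi_g h'
  exact ⟨s, by rw [← cancel_epi d, reassoc_of% hs]; simp [w']⟩

theorem Ext1IsZero.of_iso (hE : IsExactStructure E) (e : D ≅ B) (h : Ext1IsZero E D A) :
    Ext1IsZero E B A :=
  ext1IsZero_of_exists_section hE fun M f g w h' => by
    obtain ⟨l, hl⟩ := h.exists_lift hE h' e.hom
    exact ⟨e.inv ≫ l, by simp [hl]⟩

end ExactStructure

/-! ### Cotorsion pairs and Hovey triples -/

section Hovey

variable {𝓐 : Type u} [Category.{v} 𝓐] [Preadditive 𝓐] {E : ObjectProperty (ShortComplex 𝓐)}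

theorem IsCompleteCotorsionPair.ext1IsZero {C F : ObjectProperty 𝓐}
    (h : IsCompleteCotorsionPair E C F) {A B : 𝓐} (hA : C A) (hB : F B) :
    Ext1IsZero E A B :=
  (h.left_iff A).1 hA B hB

/-- The part of the axioms of a Hovey triple that yields its homotopy theory: the class `W` is only
required to be closed under extensions. -/
structure IsWeakHoveyTriple (E : ObjectProperty (ShortComplex 𝓐)) (C W F : ObjectProperty 𝓐) :
    Prop where
  middle : ∀ s : ShortComplex 𝓐, E s → W s.X₁ → W s.X₃ → W s.X₂
  pair_left : IsCompleteCotorsionPair E C (W ⊓ F)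
  pair_right : IsCompleteCotorsionPair E (C ⊓ W) F

variable [HasBinaryBiproducts 𝓐]

theorem IsHoveyTriple.isWeakHoveyTriple {C W F : ObjectProperty 𝓐}
    (h : IsHoveyTriple E C W F) :
    IsWeakHoveyTriple E C W F :=
  ⟨h.thick.middle, h.pair_left, h.pair_right⟩


theorem IsAdditiveSubcategory.inf {P Q : ObjectProperty 𝓐} (hP : IsAdditiveSubcategory P)
    (hQ : IsAdditiveSubcategory Q) : IsAdditiveSubcategory (P ⊓ Q) where
  of_iso A B e h := ⟨hP.of_iso A B e h.1, hQ.of_iso A B e h.2⟩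
  exists_zero := by
    obtain ⟨A, hA, hPA⟩ := hP.exists_zero
    obtain ⟨B, hB, hQB⟩ := hQ.exists_zero
    exact ⟨A, hA, hPA, hQ.of_iso B A (hB.iso hA) hQB⟩
  biprod A B hA hB := ⟨hP.biprod A B hA.1 hB.1, hQ.biprod A B hA.2 hB.2⟩

theorem FactorsThrough.zero {X : ObjectProperty 𝓐} (hX : IsAdditiveSubcategory X) (A B : 𝓐) :
    FactorsThrough X (0 : A ⟶ B) := by
  obtain ⟨Z, -, hZ⟩ := hX.exists_zero
  exact ⟨Z, hZ, 0, 0, comp_zero⟩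

variable [HasZeroObject 𝓐]

/-! ### Duality and closure properties of cotorsion pairs -/

namespace IsCompleteCotorsionPair

variable {C F : ObjectProperty 𝓐}

theorem op (h : IsCompleteCotorsionPair E C F) (hE : IsExactStructure E) :
    IsCompleteCotorsionPair (opConflations E) F.op C.op where
  left_iff A := (h.right_iff A.unop).trans
    ⟨fun H B hB => (ext1IsZero_op_iff hE).2 (H B.unop hB),
      fun H B hB => (ext1IsZero_op_iff hE).1 (H (Opposite.op B) hB)⟩
  right_iff B := (h.left_iff B.unop).trans
    ⟨fun H A hA => (ext1IsZero_op_iff hE).2 (H A.unop hA),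
      fun H A hA => (ext1IsZero_op_iff hE).1 (H (Opposite.op A) hA)⟩
  enough_projectives A := by
    obtain ⟨I, Q, i, d, w, h1, h2, h3⟩ := h.enough_injectives A.unop
    exact ⟨Opposite.op Q, Opposite.op I, d.op, i.op, congrArg Quiver.Hom.op w, h1, h3, h2⟩
  enough_injectives A := by
    obtain ⟨K, Q, i, d, w, h1, h2, h3⟩ := h.enough_projectives A.unop
    exact ⟨Opposite.op Q, Opposite.op K, d.op, i.op, congrArg Quiver.Hom.op w, h1, h3, h2⟩

theorem middle_left (h : IsCompleteCotorsionPair E C F) (hE : IsExactStructure E) {A B D : 𝓐}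
    {f : A ⟶ B} {g : B ⟶ D} {w : f ≫ g = 0} (hfg : E (ShortComplex.mk f g w)) (hA : C A)
    (hD : C D) : C B :=
  (h.left_iff B).2 fun _ hT => ext1IsZero_middle hE hfg (h.ext1IsZero hA hT) (h.ext1IsZero hD hT)

theorem middle_right (h : IsCompleteCotorsionPair E C F) (hE : IsExactStructure E) {A B D : 𝓐}
    {f : A ⟶ B} {g : B ⟶ D} {w : f ≫ g = 0} (hfg : E (ShortComplex.mk f g w)) (hA : F A)
    (hD : F D) : F B :=
  (h.op hE).middle_left hE.op (f := g.op) (g := f.op) (w := congrArg Quiver.Hom.op w) hfg hD hA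

theorem isAdditive_left (h : IsCompleteCotorsionPair E C F) (hE : IsExactStructure E) :
    IsAdditiveSubcategory C where
  of_iso _ B e hA := (h.left_iff B).2 fun _ hT => (h.ext1IsZero hA hT).of_iso hE e
  exists_zero := ⟨0, isZero_zero 𝓐, (h.left_iff 0).2
    fun _ _ => ext1IsZero_of_isZero hE (isZero_zero 𝓐)⟩
  biprod A B hA hB := h.middle_left hE (hE.inl_snd A B) hA hB

theorem isAdditive_right (h : IsCompleteCotorsionPair E C F) (hE : IsExactStructure E) :
    IsAdditiveSubcategory F where
  of_iso A B e hA := ((h.op hE).isAdditive_left hE.op).of_iso _ _ e.op.symm hA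
  exists_zero := by
    obtain ⟨Z, hZ, hFZ⟩ := ((h.op hE).isAdditive_left hE.op).exists_zero
    exact ⟨Z.unop, hZ.unop, hFZ⟩
  biprod A B hA hB := h.middle_right hE (hE.inl_snd A B) hA hB

end IsCompleteCotorsionPair

variable {C W F : ObjectProperty 𝓐}

namespace IsWeakHoveyTriple

/-- Passing to the opposite exchanges `C` with `F`, and with them the two cotorsion pairs. -/
theorem op (h : IsWeakHoveyTriple E C W F) (hE : IsExactStructure E) :
    IsWeakHoveyTriple (opConflations E) F.op W.op C.op where
  middle s hs h₁ h₃ := h.middle s.unop hs h₃ h₁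
  pair_left := by
    rw [← ObjectProperty.op_inf, inf_comm]
    exact h.pair_right.op hE
  pair_right := by
    rw [← ObjectProperty.op_inf, inf_comm]
    exact h.pair_left.op hE

theorem isAdditive_C (h : IsWeakHoveyTriple E C W F) (hE : IsExactStructure E) :
    IsAdditiveSubcategory C :=
  h.pair_left.isAdditive_left hE

theorem isAdditive_F (h : IsWeakHoveyTriple E C W F) (hE : IsExactStructure E) :
    IsAdditiveSubcategory F :=
  h.pair_right.isAdditive_right hE

theorem isAdditive_X (h : IsWeakHoveyTriple E C W F) (hE : IsExactStructure E) :
    IsAdditiveSubcategory (C ⊓ W ⊓ F) :=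
  (h.pair_right.isAdditive_left hE).inf (h.isAdditive_F hE)

/-- An object of `C` embeds into an object of `X` with cokernel in `C`. -/
theorem exists_embedding (h : IsWeakHoveyTriple E C W F) (hE : IsExactStructure E) {A : 𝓐}
    (hA : C A) : ∃ (M U : 𝓐) (i : A ⟶ M) (p : M ⟶ U) (w : i ≫ p = 0),
      E (ShortComplex.mk i p w) ∧ (C ⊓ W ⊓ F) M ∧ C U := by
  obtain ⟨M, U, i, p, w, h1, h2, h3⟩ := h.pair_left.enough_injectives A
  exact ⟨M, U, i, p, w, h1, ⟨⟨h.pair_left.middle_left hE h1 hA h2, h3.1⟩, h3.2⟩, h2⟩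

/-- An object of `F` is a quotient of an object of `X` with kernel in `F`. -/
theorem exists_cover (h : IsWeakHoveyTriple E C W F) (hE : IsExactStructure E) {T : 𝓐}
    (hT : F T) : ∃ (K P : 𝓐) (k : K ⟶ P) (p : P ⟶ T) (w : k ≫ p = 0),
      E (ShortComplex.mk k p w) ∧ (C ⊓ W ⊓ F) P ∧ F K := by
  obtain ⟨K, P, k, p, w, h1, h2, h3⟩ := h.pair_right.enough_projectives T
  exact ⟨K, P, k, p, w, h1, ⟨h2, h.pair_right.middle_right hE h1 h3 hT⟩, h3⟩

/-- The map lifts to a special `C`-precover `P` of `K`. As an extension of `K` by an object of `W ⊓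
F`, `P` lies in `W` and in `F` as well as in `C`, hence in `X`. -/
theorem factorsThrough_of_right (h : IsWeakHoveyTriple E C W F) (hE : IsExactStructure E)
    {A K : 𝓐} (hA : C A) (hK : (W ⊓ F) K) (f : A ⟶ K) : FactorsThrough (C ⊓ W ⊓ F) f := by
  obtain ⟨L, P, k, p, w, h1, h2, h3⟩ := h.pair_left.enough_projectives K
  obtain ⟨l, hl⟩ := (h.pair_left.ext1IsZero hA h3).exists_lift hE h1 f
  exact ⟨P, ⟨⟨h2, h.middle _ h1 h3.1 hK.1⟩, h.pair_right.middle_right hE h1 h3.2 hK.2⟩, l, p, hl⟩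

theorem factorsThrough_of_left (h : IsWeakHoveyTriple E C W F) (hE : IsExactStructure E)
    {K B : 𝓐} (hK : (C ⊓ W) K) (hB : F B) (f : K ⟶ B) : FactorsThrough (C ⊓ W ⊓ F) f := by
  obtain ⟨M, U, i, p, w, h1, h2, h3⟩ := h.pair_right.enough_injectives K
  obtain ⟨l, hl⟩ := (h.pair_right.ext1IsZero h2 hB).exists_extend hE h1 f
  exact ⟨M, ⟨⟨h.pair_left.middle_left hE h1 hK.1 h2.1, h.middle _ h1 hK.2 h2.2⟩, h3⟩, i, l, hl⟩

theorem isMonic (h : IsWeakHoveyTriple E C W F) (hE : IsExactStructure E) {A B D : 𝓐}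
    {f : A ⟶ B} {g : B ⟶ D} {w : f ≫ g = 0} (hfg : E (ShortComplex.mk f g w)) (hD : C D) :
    IsMonic (C ⊓ W ⊓ F) f := fun _ hZ k =>
  (h.pair_left.ext1IsZero hD ⟨hZ.1.2, hZ.2⟩).exists_extend hE hfg k

/-- `Q(A)` comes from the pair `(C, W ⊓ F)` and `R(A)` from `(C ⊓ W, F)`. Condition (c) holds
because `F` and `C` are closed under extensions. -/
theorem isLocalizationTriple (h : IsWeakHoveyTriple E C W F) (hE : IsExactStructure E) :
    IsLocalizationTriple C (C ⊓ W ⊓ F) F where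
  additive_C := h.isAdditive_C hE
  additive_X := h.isAdditive_X hE
  additive_D := h.isAdditive_F hE
  X_le _ hA := ⟨hA.1.1, hA.2⟩
  exists_precover A := by
    obtain ⟨K, Q, i, d, w, h1, h2, h3⟩ := h.pair_left.enough_projectives A
    exact ⟨K, Q, i, d, ⟨h2, fun Z hZ k => (h.pair_left.ext1IsZero hZ h3).exists_lift hE h1 k⟩,
      ⟨w, fun T k hk => hE.exists_lift h1 k hk⟩,
      fun T hT f => h.factorsThrough_of_right hE hT h3 f,
      fun hA => ⟨h2, h.pair_right.middle_right hE h1 h3.2 hA⟩⟩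
  exists_preenvelope A := by
    obtain ⟨I, Q, i, d, w, h1, h2, h3⟩ := h.pair_right.enough_injectives A
    exact ⟨I, Q, i, d, ⟨h3, fun Z hZ k => (h.pair_right.ext1IsZero h2 hZ).exists_extend hE h1 k⟩,
      ⟨w, fun T k hk => hE.exists_desc h1 k hk⟩,
      fun T hT f => h.factorsThrough_of_left hE h2 hT f,
      fun hA => ⟨h.pair_left.middle_left hE h1 hA h2.1, h3⟩⟩

/-! ### The partial right triangulated structure -/

variable {S : 𝓐 ⥤ 𝓐} {R : Set (RightSeq S)}

/-- `S` is any endofunctor with zero values and `R` is given by its membership criterion, so that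
the same statement covers the zero functor and, for the left-handed structure, its opposite. -/
theorem isPartialRight (h : IsWeakHoveyTriple E C W F) (hE : IsExactStructure E)
    (hS : ∀ A, IsZero (S.obj A))
    (hR : ∀ s, s ∈ R ↔ ∃ w : s.f ≫ s.g = 0, E (ShortComplex.mk s.f s.g w) ∧ C s.Z) :
    IsPartialRight S R C (C ⊓ W ⊓ F) where
  functor_additive := ⟨fun {_ _ _ _} => (hS _).eq_of_src _ _⟩
  additive_C := h.isAdditive_C hE
  additive_X := h.isAdditive_X hE
  X_le _ hA := hA.1.1
  isRightCSeq s hs := by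
    obtain ⟨w, h1, h2⟩ := (hR s).1 hs
    have := hE.epi_g h1
    refine ⟨h2, ⟨w, fun T k hk => hE.exists_desc h1 k hk⟩, (hS _).eq_of_tgt _ _, fun T k hk =>
      ⟨0, ?_⟩⟩
    rw [comp_zero, ← cancel_epi s.g, hk, comp_zero]
  of_iso s t hst hs := by
    obtain ⟨w, h1, h2⟩ := (hR s).1 hs
    obtain ⟨a, b, c, h3, h4, -⟩ := hst
    have w' : t.f ≫ t.g = 0 := by
      rw [← cancel_epi a.hom, ← reassoc_of% h3, ← h4, reassoc_of% w, zero_comp, comp_zero]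
    exact (hR t).2 ⟨w', hE.mem_of_iso h1 w' a b c h3 h4, (h.isAdditive_C hE).of_iso _ _ c h2⟩
  sum_mem s hs t ht := by
    obtain ⟨w, h1, h2⟩ := (hR s).1 hs
    obtain ⟨w', h1', h2'⟩ := (hR t).1 ht
    exact (hR _).2 ⟨_, hE.biprod_map h1 h1', (h.isAdditive_C hE).biprod _ _ h2 h2'⟩
  exists_triangle A hA := by
    obtain ⟨M, U, i, p, w, h1, h2, h3⟩ := h.exists_embedding hE hA
    exact ⟨M, U, i, p, 0, (hR _).2 ⟨w, h1, h3⟩, h2, h.isMonic hE h1 h3⟩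
  graph_mem A B hA hB f := (hR _).2 ⟨_, hE.graph f, hB⟩
  exists_cone s hs hX hf B hB f := by
    obtain ⟨w, h1, h2⟩ := (hR s).1 hs
    -- The cone is the pushout `P`. It lies in `C` as an extension of `s.Z` by `B`.
    obtain ⟨P, p, q, g', w', h3, -, h4⟩ := hE.exists_pushout h1 f
    exact ⟨P, biprod.desc p (-q), 0, (hR _).2 ⟨_, hE.of_isPushout ⟨_, _, _, h1⟩ h4,
      h.pair_left.middle_left hE h3 hB h2⟩⟩
  factor s hs t ht _ α β γ e1 e2 _ := by
    rintro ⟨k, hk⟩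
    obtain ⟨w, h1, h2⟩ := (hR s).1 hs
    obtain ⟨w', h1', h2'⟩ := (hR t).1 ht
    obtain ⟨l, hl⟩ := hE.exists_desc h1 (β - k ≫ t.f) (by
      rw [Preadditive.comp_sub, e1, reassoc_of% hk, sub_self])
    have := hE.epi_g h1
    exact ⟨l, by rw [← cancel_epi s.g, reassoc_of% hl, e2]; simp [w']⟩
  fill s hs t ht α β e := by
    obtain ⟨w, h1, h2⟩ := (hR s).1 hs
    obtain ⟨w', h1', h2'⟩ := (hR t).1 ht
    obtain ⟨γ, hγ⟩ := hE.exists_desc h1 (β ≫ t.g) (by rw [reassoc_of% e, w', comp_zero])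
    exact ⟨γ, hγ, (hS _).eq_of_tgt _ _⟩
  octahedral A B D C' A' B' f l m g d j a b hA hB hD hf hg hfl hgd hab := by
    obtain ⟨w₁, h1, h1'⟩ := (hR _).1 hfl
    obtain ⟨w₂, h2, h2'⟩ := (hR _).1 hgd
    obtain ⟨w₃, h3, h3'⟩ := (hR _).1 hab
    dsimp only at w₁ w₂ w₃ h1 h2 h3 h1' h2' h3'
    -- By the Noether isomorphism the pushout `P` of `g` along `l` is a cokernel of `f ≫ g`, so it
    -- is identified with the given `B'`. The other side of the pushout is the conflation `C' ⟶ P ⟶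
    -- A'`, which is transported to `B'`.
    obtain ⟨P, p, q, g', w', h4, h5, hpo⟩ := hE.exists_pushout h2 l
    obtain ⟨r, hr⟩ := hE.exists_desc h1 (g ≫ a) (by rw [← Category.assoc, w₃])
    have h6 := hE.comp_inflation h2 h1 hpo
    have := hE.epi_g h6
    have := hE.epi_g h3
    have := hE.epi_g h1
    obtain ⟨u, hu⟩ := hE.exists_desc h6 a w₃
    obtain ⟨v, hv⟩ := hE.exists_desc h3 p (by rw [Category.assoc, hpo.w, reassoc_of% w₁, zero_comp])
    let e : P ≅ B' := ⟨u, v, by rw [← cancel_epi p, reassoc_of% hu, hv, Category.comp_id],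
      by rw [← cancel_epi a, reassoc_of% hv, hu, Category.comp_id]⟩
    have hq : q ≫ u = r := by
      rw [← cancel_epi l, ← reassoc_of% hpo.w, hu, hr]
    have w₄ : r ≫ v ≫ g' = 0 := by
      rw [← hq, Category.assoc, e.hom_inv_id_assoc, w']
    have h7 : E (ShortComplex.mk r (v ≫ g') w₄) :=
      hE.mem_of_iso h4 w₄ (Iso.refl _) e (Iso.refl _) (by simp [e, hq])
        (by simp [reassoc_of% (show u ≫ v = 𝟙 P from e.hom_inv_id), e])
    exact ⟨r, v ≫ g', hr, (hS _).eq_of_tgt _ _, by rw [reassoc_of% hv, h5],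
      (hS _).eq_of_tgt _ _, (hR _).2 ⟨w₄, h7, h2'⟩, h.isMonic hE h7 h2'⟩

end IsWeakHoveyTriple

end Hovey

/-! ### Weak equivalences -/

section WeakEquivalence

variable {𝓐 : Type u} [Category.{v} 𝓐] {C X F G : ObjectProperty 𝓐}

theorem FactorsThrough.precomp {A B D : 𝓐} {f : B ⟶ D} (hf : FactorsThrough X f) (g : A ⟶ B) :
    FactorsThrough X (g ≫ f) := by
  obtain ⟨Z, hZ, a, b, rfl⟩ := hf
  exact ⟨Z, hZ, g ≫ a, b, Category.assoc _ _ _⟩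

theorem FactorsThrough.postcomp {A B D : 𝓐} {f : A ⟶ B} (hf : FactorsThrough X f) (g : B ⟶ D) :
    FactorsThrough X (f ≫ g) := by
  obtain ⟨Z, hZ, a, b, rfl⟩ := hf
  exact ⟨Z, hZ, a, b ≫ g, (Category.assoc _ _ _).symm⟩

variable [Preadditive 𝓐]

theorem FactorsThrough.neg {A B : 𝓐} {f : A ⟶ B} (hf : FactorsThrough X f) :
    FactorsThrough X (-f) := by
  obtain ⟨Z, hZ, a, b, rfl⟩ := hf
  exact ⟨Z, hZ, a, -b, Preadditive.comp_neg _ _⟩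

theorem FactorsThrough.sub_comm {A B : 𝓐} {f g : A ⟶ B} (h : FactorsThrough X (f - g)) :
    FactorsThrough X (g - f) := by
  simpa using h.neg

/-- `t : A ⟶ B` induces a bijection `Hom(B, T) → Hom(A, T)` modulo `X` for all `T` in `F`. -/
def IsWeakEquiv (X F : ObjectProperty 𝓐) {A B : 𝓐} (t : A ⟶ B) : Prop :=
  ∀ T : 𝓐, F T → (∀ u : A ⟶ T, ∃ v : B ⟶ T, FactorsThrough X (u - t ≫ v)) ∧
    ∀ v : B ⟶ T, FactorsThrough X (t ≫ v) → FactorsThrough X v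

theorem IsWeakEquiv.of_comp {A B D : 𝓐} {s : A ⟶ B} {t : B ⟶ D} (hs : IsWeakEquiv X F s)
    (hst : IsWeakEquiv X F (s ≫ t)) : IsWeakEquiv X F t := by
  refine fun T hT => ⟨fun u => ?_, fun v hv => ?_⟩
  · obtain ⟨v, hv⟩ := (hst T hT).1 (s ≫ u)
    exact ⟨v, (hs T hT).2 _ (by simpa using hv)⟩
  · exact (hst T hT).2 v (by simpa using hv.precomp s)

variable [HasBinaryBiproducts 𝓐]

/-- Without this, equality in the quotient would only mean equivalence under the generated
congruence. Transitivity is where closure of `X` under biproducts enters. -/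
theorem congruence_stableRel (hX : IsAdditiveSubcategory X) : Congruence (StableRel C X) where
  comp_left f _ _ h := by
    simpa [StableRel, Preadditive.comp_sub] using FactorsThrough.precomp h f.hom
  comp_right g h := by
    simpa [StableRel, Preadditive.sub_comp] using FactorsThrough.postcomp h g.hom
  equivalence :=
    { refl f := by simpa [StableRel] using FactorsThrough.zero hX _ _
      symm h := FactorsThrough.sub_comm h
      trans h h' := by simpa [StableRel] using FactorsThrough.add hX h h' }

theorem toStable_map_eq_iff (hX : IsAdditiveSubcategory X) {A B : C.FullSubcategory}
    (f g : A ⟶ B) :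
    (toStable C X).map f = (toStable C X).map g ↔ FactorsThrough X (f.hom - g.hom) :=
  have := congruence_stableRel (C := C) hX
  CategoryTheory.Quotient.functor_map_eq_iff (StableRel C X) f g

namespace IsWeakEquiv

theorem comp (hX : IsAdditiveSubcategory X) {A B D : 𝓐} {s : A ⟶ B} {t : B ⟶ D}
    (hs : IsWeakEquiv X F s) (ht : IsWeakEquiv X F t) : IsWeakEquiv X F (s ≫ t) := by
  refine fun T hT => ⟨fun u => ?_, fun v hv => ?_⟩
  · obtain ⟨v, hv⟩ := (hs T hT).1 u
    obtain ⟨v', hv'⟩ := (ht T hT).1 v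
    exact ⟨v', by simpa using hv.add hX (hv'.precomp s)⟩
  · exact (ht T hT).2 v ((hs T hT).2 _ (by simpa using hv))

theorem congr (hX : IsAdditiveSubcategory X) {A B : 𝓐} {s t : A ⟶ B}
    (hst : FactorsThrough X (s - t)) (hs : IsWeakEquiv X F s) : IsWeakEquiv X F t := by
  refine fun T hT => ⟨fun u => ?_, fun v hv => (hs T hT).2 v ?_⟩
  · obtain ⟨v, hv⟩ := (hs T hT).1 u
    exact ⟨v, by simpa using hv.add hX (hst.postcomp v)⟩
  · simpa using (hst.postcomp v).add hX hv

theorem of_map_isIso (hX : IsAdditiveSubcategory X) {A B : C.FullSubcategory} (t : A ⟶ B)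
    [IsIso ((toStable C X).map t)] : IsWeakEquiv X F t.hom := by
  obtain ⟨s, hs⟩ := (toStable C X).map_surjective (inv ((toStable C X).map t))
  have h1 : FactorsThrough X ((𝟙 A : A ⟶ A).hom - (t ≫ s).hom) :=
    (toStable_map_eq_iff hX _ _).1 (by rw [Functor.map_comp, hs]; simp)
  have h2 : FactorsThrough X ((𝟙 B : B ⟶ B).hom - (s ≫ t).hom) :=
    (toStable_map_eq_iff hX _ _).1 (by rw [Functor.map_comp, hs]; simp)
  refine fun T hT => ⟨fun u => ⟨s.hom ≫ u, by simpa using h1.postcomp u⟩, fun v hv => ?_⟩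
  simpa using (h2.postcomp v).add hX (hv.precomp s.hom)

/-- Yoneda: `A` and `B` are themselves admissible test objects. Testing on `A` yields the inverse,
and testing on `B` shows that it is two-sided. -/
theorem map_isIso (hX : IsAdditiveSubcategory X) (hGF : G ≤ F) {A B : G.FullSubcategory}
    (t : A ⟶ B) (ht : IsWeakEquiv X F t.hom) : IsIso ((toStable G X).map t) := by
  obtain ⟨s, hs⟩ := (ht _ (hGF _ A.property)).1 (𝟙 A.obj)
  have h1 : (toStable G X).map (t ≫ ObjectProperty.homMk s) = (toStable G X).map (𝟙 A) :=
    (toStable_map_eq_iff hX _ _).2 hs.sub_comm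
  have h2 : (toStable G X).map (ObjectProperty.homMk s ≫ t) = (toStable G X).map (𝟙 B) := by
    refine (toStable_map_eq_iff hX _ _).2 ((ht _ (hGF _ B.property)).2 _ ?_)
    simpa using hs.sub_comm.postcomp t.hom
  exact ⟨(toStable G X).map (ObjectProperty.homMk s), by rw [← Functor.map_comp, h1]; simp,
    by rw [← Functor.map_comp, h2]; simp⟩

variable [HasZeroObject 𝓐] {E : ObjectProperty (ShortComplex 𝓐)} {W : ObjectProperty 𝓐}

/-- A morphism of conflations whose first two components are weak equivalences is a weak
equivalence. -/
theorem third (h : IsWeakHoveyTriple E C W F) (hE : IsExactStructure E) {A B D A' B' D' : 𝓐}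
    {f : A ⟶ B} {g : B ⟶ D} {f' : A' ⟶ B'} {g' : B' ⟶ D'} {w : f ≫ g = 0} {w' : f' ≫ g' = 0}
    (hs : E (ShortComplex.mk f g w)) (hs' : E (ShortComplex.mk f' g' w')) (hD : C D) (hD' : C D')
    {α : A ⟶ A'} {β : B ⟶ B'} {γ : D ⟶ D'} (h₁ : f ≫ β = α ≫ f') (h₂ : g ≫ γ = β ≫ g')
    (hα : IsWeakEquiv (C ⊓ W ⊓ F) F α) (hβ : IsWeakEquiv (C ⊓ W ⊓ F) F β) :
    IsWeakEquiv (C ⊓ W ⊓ F) F γ := by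
  intro T hT
  have hX := h.isAdditive_X hE
  -- A map to `T` factors through `X` exactly when it lifts along `p`, since `Ext¹(X, K) = 0` and
  -- `P` lies in `X`. The kernel `K` acts as a loop object of `T` and is again a test object.
  obtain ⟨K, P, k, p, wp, hp, hP, hK⟩ := h.exists_cover hE hT
  have := hE.mono_f hp
  have := hE.epi_g hs
  have := hE.epi_g hs'
  have lift {M : 𝓐} {x : M ⟶ T} (hx : FactorsThrough (C ⊓ W ⊓ F) x) : ∃ y, y ≫ p = x := by
    obtain ⟨Z, hZ, a, b, rfl⟩ := hx
    obtain ⟨b', rfl⟩ := (h.pair_right.ext1IsZero hZ.1 hK).exists_lift hE hp b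
    exact ⟨a ≫ b', Category.assoc _ _ _⟩
  have extend {N : 𝓐} {x : A ⟶ N} (hx : FactorsThrough (C ⊓ W ⊓ F) x) :
      ∃ y : B ⟶ N, FactorsThrough (C ⊓ W ⊓ F) y ∧ f ≫ y = x := by
    obtain ⟨Z, hZ, a, b, rfl⟩ := hx
    obtain ⟨a', rfl⟩ := h.isMonic hE hs hD Z hZ a
    exact ⟨a' ≫ b, ⟨Z, hZ, a', b, rfl⟩, by simp⟩
  have extend' {N : 𝓐} {x : A' ⟶ N} (hx : FactorsThrough (C ⊓ W ⊓ F) x) :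
      ∃ y : B' ⟶ N, FactorsThrough (C ⊓ W ⊓ F) y ∧ f' ≫ y = x := by
    obtain ⟨Z, hZ, a, b, rfl⟩ := hx
    obtain ⟨a', rfl⟩ := h.isMonic hE hs' hD' Z hZ a
    exact ⟨a' ≫ b, ⟨Z, hZ, a', b, rfl⟩, by simp⟩
  refine ⟨fun u => ?_, fun v hv => ?_⟩
  · -- correct `u` so that it vanishes on `B` modulo `X`
    obtain ⟨v, hv⟩ := (hβ T hT).1 (g ≫ u)
    have hv' : FactorsThrough (C ⊓ W ⊓ F) (f' ≫ v) := by
      refine (hα T hT).2 _ ?_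
      have := (hv.precomp f).neg
      rwa [Preadditive.comp_sub, reassoc_of% w, zero_comp, zero_sub, neg_neg, reassoc_of% h₁]
        at this
    obtain ⟨y, hy, hy'⟩ := extend' hv'
    obtain ⟨x, hx⟩ := hE.exists_desc hs' (v - y) (by rw [Preadditive.comp_sub, hy', sub_self])
    have hd : FactorsThrough (C ⊓ W ⊓ F) (g ≫ (u - γ ≫ x)) := by
      have := hv.add hX (hy.precomp β)
      convert this using 1
      rw [Preadditive.comp_sub, reassoc_of% h₂, hx, Preadditive.comp_sub]
      abel
    -- lift to `P` and correct the restriction to `A` of the lift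
    obtain ⟨z, hz⟩ := lift hd
    obtain ⟨m, hm⟩ := hE.exists_lift hp (f ≫ z) (by
      rw [Category.assoc, hz, reassoc_of% w, zero_comp])
    obtain ⟨m', hm'⟩ := (hα K hK).1 m
    obtain ⟨y₁, hy₁, hy₁'⟩ := extend hm'
    obtain ⟨z', hz'⟩ := h.isMonic hE hs' hD' P hP (m' ≫ k)
    obtain ⟨x', hx'⟩ := hE.exists_desc hs' (z' ≫ p) (by
      rw [reassoc_of% hz', wp, comp_zero])
    obtain ⟨ζ, hζ⟩ := hE.exists_desc hs (z - β ≫ z' - y₁ ≫ k) (by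
      simp only [Preadditive.comp_sub]
      rw [reassoc_of% h₁, hz', reassoc_of% hy₁', ← hm]
      simp)
    refine ⟨x + x', ?_⟩
    have key : u - γ ≫ (x + x') = ζ ≫ p := by
      rw [← cancel_epi g, reassoc_of% hζ]
      simp only [Preadditive.sub_comp, Category.assoc, hz, hx', wp, comp_zero, sub_zero,
        Preadditive.comp_sub, Preadditive.comp_add, reassoc_of% h₂]
      abel
    exact key ▸ ⟨P, hP, ζ, p, rfl⟩
  -- Both `γ ≫ v` and `g' ≫ v` lift to `P`, as `a` and `b`. The aim is to change `b` by a map into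
  -- `K` so that it vanishes on `A'` and descends to a lift of `v`.
  · obtain ⟨a, ha⟩ := lift hv
    obtain ⟨b, hb⟩ := lift ((hβ T hT).2 (g' ≫ v) (by
      rw [← reassoc_of% h₂]
      exact hv.precomp g))
    obtain ⟨m, hm⟩ := hE.exists_lift hp (f' ≫ b) (by
      rw [Category.assoc, hb, reassoc_of% w', zero_comp])
    obtain ⟨n, hn⟩ := hE.exists_lift hp (β ≫ b - g ≫ a) (by
      rw [Preadditive.sub_comp, Category.assoc, Category.assoc, hb, ha, reassoc_of% h₂, sub_self])
    have hnm : f ≫ n = α ≫ m := by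
      rw [← cancel_mono k, Category.assoc, Category.assoc, hn, hm, Preadditive.comp_sub,
        reassoc_of% h₁, reassoc_of% w, zero_comp, sub_zero]
    -- The map `n` measures how far `β ≫ b` is from coming from `D`. Its transfer `n'` to `B'`
    -- restricts to `m` on `A'` modulo `X`, and `y` removes the remaining error exactly.
    obtain ⟨n', hn'⟩ := (hβ K hK).1 n
    obtain ⟨y, hy, hy'⟩ := extend' ((hα K hK).2 (m - f' ≫ n') (by
      have := hn'.precomp f
      rwa [Preadditive.comp_sub, hnm, reassoc_of% h₁, ← Preadditive.comp_sub] at this))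
    obtain ⟨b', hb'⟩ := hE.exists_desc hs' (b - n' ≫ k - y ≫ k) (by
      simp only [Preadditive.comp_sub]
      rw [reassoc_of% hy', ← hm]
      simp)
    refine ⟨P, hP, b', p, ?_⟩
    rw [← cancel_epi g', reassoc_of% hb']
    simp [wp, hb]

/-- A special preenvelope is a weak equivalence. -/
theorem of_special (h : IsWeakHoveyTriple E C W F) (hE : IsExactStructure E) {A M U : 𝓐}
    {i : A ⟶ M} {p : M ⟶ U} {w : i ≫ p = 0} (hs : E (ShortComplex.mk i p w)) (hA : C A)
    (hM : C M) (hi : IsMonic (C ⊓ F) i) (hU : LeftPerp (C ⊓ W ⊓ F) (C ⊓ F) U) :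
    IsWeakEquiv (C ⊓ W ⊓ F) F i := by
  intro T hT
  have hX := h.isAdditive_X hE
  -- The hypotheses on `i` and `U` concern targets in `C ⊓ F` only. The cover `Q` of `T` lies there,
  -- and maps from objects of `C` to `T` lift to `Q`, uniquely modulo `X` since `K` is in `W ⊓ F`.
  obtain ⟨K, Q, k, q, wq, hq, hQ, hK⟩ := h.pair_left.enough_projectives T
  have hQ' : (C ⊓ F) Q := ⟨hQ, h.pair_right.middle_right hE hq hK.2 hT⟩
  have lift {Z : 𝓐} (hZ : C Z) (x : Z ⟶ T) : ∃ y, y ≫ q = x :=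
    (h.pair_left.ext1IsZero hZ hK).exists_lift hE hq x
  refine ⟨fun u => ?_, fun v hv => ?_⟩
  · obtain ⟨u, rfl⟩ := lift hA u
    obtain ⟨v, rfl⟩ := hi Q hQ' u
    exact ⟨v ≫ q, by simpa using FactorsThrough.zero hX _ _⟩
  · obtain ⟨v, rfl⟩ := lift hM v
    obtain ⟨Z, hZ, x, y, hxy⟩ := hv
    obtain ⟨y, rfl⟩ := lift hZ.1.1 y
    obtain ⟨n, hn⟩ := hE.exists_lift hq (i ≫ v - x ≫ y) (by simp [hxy])
    have hiv : FactorsThrough (C ⊓ W ⊓ F) (i ≫ v) := by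
      have := ((h.factorsThrough_of_right hE hA hK n).postcomp k).add hX ⟨Z, hZ, x, y, rfl⟩
      simpa [hn] using this
    obtain ⟨Z', hZ', x', y', hxy'⟩ := hiv
    obtain ⟨x', rfl⟩ := hi Z' ⟨hZ'.1.1, hZ'.2⟩ x'
    obtain ⟨l, hl⟩ := hE.exists_desc hs (v - x' ≫ y') (by simp [← hxy'])
    have := ((hU Q hQ' l).precomp p).add hX ⟨Z', hZ', x', y', rfl⟩
    rw [hl, sub_add_cancel] at this
    exact this.postcomp q

end IsWeakEquiv

/-! ### Stabilizing subcategories -/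

namespace IsWeakHoveyTriple

variable [HasZeroObject 𝓐] {E : ObjectProperty (ShortComplex 𝓐)} {W : ObjectProperty 𝓐}
  {S : 𝓐 ⥤ 𝓐} {R : Set (RightSeq S)}

theorem isSpecialPreenveloping (h : IsWeakHoveyTriple E C W F) (hE : IsExactStructure E)
    (hR : ∀ s, s ∈ R ↔ ∃ w : s.f ≫ s.g = 0, E (ShortComplex.mk s.f s.g w) ∧ C s.Z) :
    IsSpecialPreenveloping S R C (C ⊓ W ⊓ F) (C ⊓ F) where
  additive := (h.isAdditive_C hE).inf (h.isAdditive_F hE)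
  X_le _ hA := ⟨hA.1.1, hA.2⟩
  le_C _ hA := hA.1
  exists_triangle A hA := by
    obtain ⟨I, Q, i, d, w, h1, h2, h3⟩ := h.pair_right.enough_injectives A
    exact ⟨{
      M := I
      U := Q
      i := i
      p := d
      q := 0
      mem := (hR _).2 ⟨w, h1, h2.1⟩
      preenvelope := ⟨⟨h.pair_left.middle_left hE h1 hA h2.1, h3⟩,
        fun Z hZ k => (h.pair_right.ext1IsZero h2 hZ.2).exists_extend hE h1 k⟩
      perp := fun B hB f => h.factorsThrough_of_left hE h2 hB.2 f }⟩

/-- The preenvelopes and `t` are weak equivalences, so by two-out-of-three in the defining square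
`R(t)` is one too. It lies between objects of `C ⊓ F`, where weak equivalences are invertible modulo
`X`. -/
theorem isIso_repl_map (h : IsWeakHoveyTriple E C W F) (hE : IsExactStructure E)
    (hR : ∀ s, s ∈ R ↔ ∃ w : s.f ≫ s.g = 0, E (ShortComplex.mk s.f s.g w) ∧ C s.Z)
    (hp : IsPartialRight S R C (C ⊓ W ⊓ F))
    (hs : IsSpecialPreenveloping S R C (C ⊓ W ⊓ F) (C ⊓ F))
    (j : ∀ A : C.FullSubcategory, SpecialTriangle R (C ⊓ W ⊓ F) (C ⊓ F) A.obj)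
    {A B : C.FullSubcategory} (t : A ⟶ B) (ht : IsWeakEquiv (C ⊓ W ⊓ F) F t.hom) :
    IsIso ((hp.repl hs j).map ((toStable C (C ⊓ W ⊓ F)).map t)) := by
  have hX := h.isAdditive_X hE
  have hj (A : C.FullSubcategory) : IsWeakEquiv (C ⊓ W ⊓ F) F (j A).i := by
    obtain ⟨w, h1, h2⟩ := (hR _).1 (j A).mem
    exact .of_special h hE h1 A.property (j A).preenvelope.1.1 (j A).preenvelope.2 (j A).perp
  refine IsWeakEquiv.map_isIso (F := F) hX (fun _ hA => hA.2) _ ((hj A).of_comp ?_)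
  have := (IsPartialRight.exists_replMap (j A) (j B) t.hom).choose_spec
  have h' := ht.comp hX (hj B)
  rwa [← this] at h'

/-- Both given triangles are replaced by isomorphic standard ones, that is, by conflations. The
square of preenvelopes is transported to them and made strictly commutative, and the induced map `τ`
of cokernels, carried back, is the required `t`. -/
theorem isStabilizing (h : IsWeakHoveyTriple E C W F) (hE : IsExactStructure E)
    (hR : ∀ s, s ∈ R ↔ ∃ w : s.f ≫ s.g = 0, E (ShortComplex.mk s.f s.g w) ∧ C s.Z)
    (hp : IsPartialRight S R C (C ⊓ W ⊓ F)) : IsStabilizing hp (C ⊓ F) := by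
  have hG : IsSpecialPreenveloping S R C (C ⊓ W ⊓ F) (C ⊓ F) := h.isSpecialPreenveloping hE hR
  refine ⟨hG, ?_⟩
  intro e j A B f f' hff' D D' g k g' k' hd hd'
  have hX := h.isAdditive_X hE
  obtain ⟨_, ⟨A₁, B₁, D₁, f₁, g₁, k₁, mem, monic, δ, ξ, h₁, h₂, h₃⟩, a, b, c, e₁, e₂, e₃⟩ := hd
  obtain ⟨_, ⟨A₂, B₂, D₂, f₂, g₂, k₂, mem', monic', δ', ξ', h₁', h₂', h₃'⟩, a', b', c',
    e₁', e₂', e₃'⟩ := hd'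
  obtain ⟨w, hs, hD⟩ := (hR _).1 mem
  obtain ⟨w', hs', hD'⟩ := (hR _).1 mem'
  dsimp only at a b c e₁ e₂ e₃ a' b' c' e₁' e₂' e₃' w w' hs hs'
  -- The last map of the standard triangle is kept as a map `x` into the suspension of `A₁`; its
  -- description as the class of `ξ` is needed only for `hk`.
  obtain ⟨x, e₃, hx⟩ : ∃ x : (toStable C (C ⊓ W ⊓ F)).obj D₁ ⟶
      (hp.susp e).obj ((toStable C (C ⊓ W ⊓ F)).obj A₁), k ≫ (hp.susp e).map a.hom = c.hom ≫ x ∧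
      x = (toStable C (C ⊓ W ⊓ F)).map (Y := ⟨(e A₁).U, hp.U_mem (e A₁)⟩)
        (ObjectProperty.homMk ξ) := ⟨_, e₃, rfl⟩
  obtain ⟨x', e₃', hx'⟩ : ∃ x : (toStable C (C ⊓ W ⊓ F)).obj D₂ ⟶
      (hp.susp e).obj ((toStable C (C ⊓ W ⊓ F)).obj A₂), k' ≫ (hp.susp e).map a'.hom = c'.hom ≫ x ∧
      x = (toStable C (C ⊓ W ⊓ F)).map (Y := ⟨(e A₂).U, hp.U_mem (e A₂)⟩)
        (ObjectProperty.homMk ξ') := ⟨_, e₃', rfl⟩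
  have hj (A : C.FullSubcategory) : IsWeakEquiv (C ⊓ W ⊓ F) F ((j A).hom hG).hom := by
    obtain ⟨w, h1, h2⟩ := (hR _).1 (j A).mem
    exact .of_special h hE h1 A.property (j A).preenvelope.1.1 (j A).preenvelope.2 (j A).perp
  have hwe {A A₁ B B₁ : C.FullSubcategory}
      (a : (toStable C (C ⊓ W ⊓ F)).obj A ≅ (toStable C (C ⊓ W ⊓ F)).obj A₁)
      (b : (toStable C (C ⊓ W ⊓ F)).obj B ≅ (toStable C (C ⊓ W ⊓ F)).obj B₁) (i : A ⟶ B)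
      (hi : IsWeakEquiv (C ⊓ W ⊓ F) F i.hom) : ∃ x : A₁ ⟶ B₁, IsWeakEquiv (C ⊓ W ⊓ F) F x.hom ∧
        (toStable C (C ⊓ W ⊓ F)).map x = a.inv ≫ (toStable C (C ⊓ W ⊓ F)).map i ≫ b.hom := by
    obtain ⟨y, hy⟩ := (toStable C (C ⊓ W ⊓ F)).map_surjective a.inv
    obtain ⟨z, hz⟩ := (toStable C (C ⊓ W ⊓ F)).map_surjective b.hom
    have : IsIso ((toStable C (C ⊓ W ⊓ F)).map y) := hy ▸ inferInstance
    have : IsIso ((toStable C (C ⊓ W ⊓ F)).map z) := hz ▸ inferInstance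
    exact ⟨y ≫ i ≫ z, (IsWeakEquiv.of_map_isIso hX y).comp hX
      (hi.comp hX (IsWeakEquiv.of_map_isIso hX z)), by simp [hy, hz]⟩
  obtain ⟨φ, hφ, hφ'⟩ := hwe a a' _ (hj A)
  obtain ⟨θ₀, hθ₀, hθ₀'⟩ := hwe b b' _ (hj B)
  -- correct `θ₀` so that the square of `f₁` and `f₂` commutes
  obtain ⟨θ, hθ, hθ', hsq⟩ : ∃ θ : B₁ ⟶ B₂, IsWeakEquiv (C ⊓ W ⊓ F) F θ.hom ∧
      (toStable C (C ⊓ W ⊓ F)).map θ = (toStable C (C ⊓ W ⊓ F)).map θ₀ ∧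
      f₁.hom ≫ θ.hom = φ.hom ≫ f₂.hom := by
    have : (toStable C (C ⊓ W ⊓ F)).map (φ ≫ f₂) = (toStable C (C ⊓ W ⊓ F)).map (f₁ ≫ θ₀) := by
      rw [Functor.map_comp, Functor.map_comp, hφ', hθ₀', Category.assoc, Category.assoc, ← e₁',
        ← Functor.map_comp_assoc, hff', Functor.map_comp_assoc, ← cancel_epi a.hom,
        a.hom_inv_id_assoc, ← reassoc_of% e₁, b.hom_inv_id_assoc]
    obtain ⟨Z, hZ, x, y, hxy⟩ := (toStable_map_eq_iff hX _ _).1 this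
    obtain ⟨x', rfl⟩ := monic Z hZ x
    have hf : FactorsThrough (C ⊓ W ⊓ F) (θ₀.hom - (θ₀.hom + x' ≫ y)) :=
      ⟨Z, hZ, x', -y, by simp⟩
    refine ⟨ObjectProperty.homMk (θ₀.hom + x' ≫ y), hθ₀.congr hX hf,
      (toStable_map_eq_iff hX _ _).2 hf.sub_comm, ?_⟩
    rw [Category.assoc] at hxy
    simp [hxy]
  obtain ⟨τ, hτ⟩ := hE.exists_desc hs (θ.hom ≫ g₂.hom) (by rw [reassoc_of% hsq, w', comp_zero])
  have hτ' : IsWeakEquiv (C ⊓ W ⊓ F) F τ := .third h hE hs hs' hD hD' hsq hτ hφ hθ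
  have hg : (toStable C (C ⊓ W ⊓ F)).map g₁ ≫ (toStable C (C ⊓ W ⊓ F)).map
      (ObjectProperty.homMk τ : D₁ ⟶ D₂) =
      (toStable C (C ⊓ W ⊓ F)).map θ ≫ (toStable C (C ⊓ W ⊓ F)).map g₂ := by
    rw [← Functor.map_comp, ← Functor.map_comp]
    congr 1
    ext
    exact hτ
  have hk : x ≫ (hp.susp e).map ((toStable C (C ⊓ W ⊓ F)).map φ) =
      (toStable C (C ⊓ W ⊓ F)).map (ObjectProperty.homMk τ : D₁ ⟶ D₂) ≫ x' := by
    rw [hx, hx']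
    change (toStable C (C ⊓ W ⊓ F)).map (X := D₁) (Y := ⟨(e A₂).U, hp.U_mem (e A₂)⟩)
        (ObjectProperty.homMk (ξ ≫ hp.suspMap (e A₁) (e A₂) φ.hom)) =
      (toStable C (C ⊓ W ⊓ F)).map (X := D₁) (Y := ⟨(e A₂).U, hp.U_mem (e A₂)⟩)
        (ObjectProperty.homMk (τ ≫ ξ'))
    refine (toStable_map_eq_iff hX _ _).2 ?_
    obtain ⟨σ, k₁, k₂, -⟩ := hp.suspMap_spec (e A₁) (e A₂) φ.hom
    -- The two routes from `B₁` to the `X`-term of `A₂` agree on `A₁`, so their difference descends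
    -- to `D₁`. Followed by the map to `U`, it is the difference of the two composites, which thus
    -- factors through `X`.
    obtain ⟨l, hl⟩ := hE.exists_desc hs (δ ≫ σ - θ.hom ≫ δ') (by
      rw [Preadditive.comp_sub, reassoc_of% h₁, k₁, reassoc_of% hsq, h₁', sub_self])
    refine ⟨(e A₂).M, (e A₂).preenvelope.1, l, (e A₂).p, ?_⟩
    have := hE.epi_g hs
    rw [← cancel_epi g₁.hom, reassoc_of% hl]
    simp only [ObjectProperty.homMk_hom,
      Preadditive.sub_comp, Preadditive.comp_sub, Category.assoc]
    rw [reassoc_of% h₂, k₂, reassoc_of% hτ, h₂']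
  refine ⟨c.hom ≫ (toStable C (C ⊓ W ⊓ F)).map (ObjectProperty.homMk τ : D₁ ⟶ D₂) ≫ c'.inv,
    ?_, ?_, ?_⟩
  · rw [reassoc_of% e₂, reassoc_of% hg, hθ', hθ₀']
    simp only [Category.assoc, Iso.hom_inv_id_assoc]
    rw [← reassoc_of% e₂', c'.hom_inv_id, Category.comp_id]
  · have ha : (toStable C (C ⊓ W ⊓ F)).map ((j A).hom hG) =
        a.hom ≫ (toStable C (C ⊓ W ⊓ F)).map φ ≫ a'.inv := by simp [hφ']
    rw [ha, Functor.map_comp, reassoc_of% e₃, Functor.map_comp, reassoc_of% hk, Category.assoc,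
      Category.assoc]
    congr 2
    rw [Iso.eq_inv_comp, ← reassoc_of% e₃', ← Functor.map_comp, a'.hom_inv_id, CategoryTheory.Functor.map_id,
      Category.comp_id]
  · have := h.isIso_repl_map hE hR hp hG j (ObjectProperty.homMk τ : D₁ ⟶ D₂) hτ'
    rw [Functor.map_comp, Functor.map_comp]
    infer_instance

end IsWeakHoveyTriple

end WeakEquivalence

/-! ### The pre-partial triangulated structure -/

section Assembly

variable {𝓐 : Type u} [Category.{v} 𝓐] [Preadditive 𝓐] [HasZeroObject 𝓐]
  {E : ObjectProperty (ShortComplex 𝓐)}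

/-- The zero endofunctor is left adjoint to itself. -/
noncomputable def zeroAdjunction (𝓐 : Type u) [Category.{v} 𝓐] [Preadditive 𝓐]
    [HasZeroObject 𝓐] : zeroFunctor 𝓐 ⊣ zeroFunctor 𝓐 :=
  Adjunction.mkOfHomEquiv
    { homEquiv := fun _ _ => ⟨fun _ => 0, fun _ => 0, fun _ => (isZero_zero 𝓐).eq_of_src _ _,
        fun _ => (isZero_zero 𝓐).eq_of_tgt _ _⟩ }

theorem mem_leftTriangles_ofOp (F : ObjectProperty 𝓐) (s : RightSeq (zeroFunctor 𝓐).op) :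
    LeftSeq.ofOp s ∈ leftTriangles E F ↔
      ∃ w : s.f ≫ s.g = 0, opConflations E (ShortComplex.mk s.f s.g w) ∧ F.op s.Z :=
  ⟨fun ⟨w, h⟩ => ⟨congrArg Quiver.Hom.op w, h⟩, fun ⟨w, h⟩ => ⟨congrArg Quiver.Hom.unop w, h⟩⟩

/-- The identities with signs are between maps out of or into zero. What remains is the kernel
property of `t` and the cokernel property of `s`. For the factorizations, subtracting the given one
from `β` leaves a map into the kernel (`β - s.g ≫ a`) or out of the cokernel (`β - b ≫ t.v`). -/
theorem areCompatible (hE : IsExactStructure E) (C F X : ObjectProperty 𝓐) :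
    AreCompatible (zeroAdjunction 𝓐) (leftTriangles E F) (rightTriangles E C) C F X where
  fill_left := by
    rintro s ⟨w, hs, -⟩ t ⟨w', ht, -⟩ - - β γ h
    obtain ⟨α, hα⟩ := hE.exists_lift ht (s.f ≫ β) (by
      rw [Category.assoc, ← h, reassoc_of% w, zero_comp])
    exact ⟨α, hα, (isZero_zero 𝓐).eq_of_src _ _⟩
  fill_right := by
    rintro s ⟨w, hs, -⟩ t ⟨w', ht, -⟩ - - β α h
    obtain ⟨γ, hγ⟩ := hE.exists_desc hs (β ≫ t.w) (by
      rw [← reassoc_of% h, w', comp_zero])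
    exact ⟨γ, hγ, (isZero_zero 𝓐).eq_of_tgt _ _⟩
  factor_left := by
    rintro s ⟨w, hs, -⟩ t ⟨w', ht, -⟩ - - - α β γ h₁ h₂ - ⟨a, rfl⟩
    have := hE.mono_f ht
    obtain ⟨b, hb⟩ := hE.exists_lift ht (β - s.g ≫ a) (by
      rw [Preadditive.sub_comp, ← h₂, Category.assoc, sub_self])
    exact ⟨b, by rw [← cancel_mono t.v, Category.assoc, hb, Preadditive.comp_sub, h₁,
      reassoc_of% w, zero_comp, sub_zero]⟩
  factor_right := by
    rintro s ⟨w, hs, -⟩ t ⟨w', ht, -⟩ - - - α β γ h₁ h₂ - ⟨b, rfl⟩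
    have := hE.epi_g hs
    obtain ⟨a, ha⟩ := hE.exists_desc hs (β - b ≫ t.v) (by
      rw [Preadditive.comp_sub, h₁, Category.assoc, sub_self])
    exact ⟨a, by rw [← cancel_epi s.g, reassoc_of% ha, Preadditive.sub_comp, h₂, Category.assoc,
      w', comp_zero, sub_zero]⟩

variable [HasBinaryBiproducts 𝓐] {C W F : ObjectProperty 𝓐}

theorem IsWeakHoveyTriple.isPrePartialTriangulated (h : IsWeakHoveyTriple E C W F)
    (hE : IsExactStructure E) :
    IsPrePartialTriangulated (zeroFunctor 𝓐) (zeroFunctor 𝓐) (leftTriangles E F)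
      (rightTriangles E C) C F (C ⊓ W ⊓ F) := by
  have hX : (C ⊓ W ⊓ F).op = F.op ⊓ W.op ⊓ C.op := by
    rw [inf_assoc, inf_comm C, inf_comm W]
    rfl
  have hG : (C ⊓ F).op = F.op ⊓ C.op := by
    rw [inf_comm]
    rfl
  have right := h.isPartialRight hE (S := zeroFunctor 𝓐) (R := rightTriangles E C)
    (fun _ => isZero_zero 𝓐) (fun _ => Iff.rfl)
  have left := (h.op hE).isPartialRight hE.op (S := (zeroFunctor 𝓐).op)
    (R := {s | LeftSeq.ofOp s ∈ leftTriangles E F}) (fun _ => (isZero_zero 𝓐).op)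
    (mem_leftTriangles_ofOp F)
  have stab := (h.op hE).isStabilizing hE.op (mem_leftTriangles_ofOp F) left
  -- Duality yields the intersections in reversed order. The stabilizing condition depends on the
  -- proof of the left structure, so both are transported together along these equalities.
  have key : ∀ X G : ObjectProperty 𝓐ᵒᵖ, X = F.op ⊓ W.op ⊓ C.op → G = F.op ⊓ C.op →
      ∃ left : IsPartialRight (zeroFunctor 𝓐).op {s | LeftSeq.ofOp s ∈ leftTriangles E F} F.op X,
        IsStabilizing left G := by
    rintro _ _ rfl rfl
    exact ⟨left, stab⟩
  obtain ⟨left, stab⟩ := key _ _ hX hG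
  exact ⟨right, left, h.isStabilizing hE (fun _ => Iff.rfl) right, stab,
    zeroAdjunction 𝓐, areCompatible hE C F _⟩

end Assembly

end ExactHomotopy

theorem theorem6p4 {𝓐 : Type u} [Category.{v} 𝓐] [Preadditive 𝓐] [HasZeroObject 𝓐]
    [HasBinaryBiproducts 𝓐] (E : ObjectProperty (ShortComplex 𝓐)) (hE : IsExactStructure E)
    (C W F : ObjectProperty 𝓐) (hCWF : IsHoveyTriple E C W F) :
    IsLocalizationTriple C (C ⊓ W ⊓ F) F ∧
      IsPrePartialTriangulated (zeroFunctor 𝓐) (zeroFunctor 𝓐) (leftTriangles E F)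
        (rightTriangles E C) C F (C ⊓ W ⊓ F) :=
  ⟨hCWF.isWeakHoveyTriple.isLocalizationTriple hE,
    hCWF.isWeakHoveyTriple.isPrePartialTriangulated hE⟩
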